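/- Let $k$ be an algebraically closed field and let $\Gamma$ be a finite acyclic quiver with vertex set $\Gamma_0$; paths are composed from left to right. For each $l\in\Gamma_0$ let $A_l\cong k\Sigma_l/\Omega_l$ be an algebra presented by a finite quiver $\Sigma_l$ and an admissible ideal $\Omega_l$. Let $k(\Gamma,\mathcal A)$ be the generalized path algebra: it is spanned by the sequences $a_1\beta_1a_2\cdots a_n\beta_na_{n+1}$ with $\beta_1\cdots\beta_n$ a path of $\Gamma$, $a_l\in A_{s(\beta_l)}$, $a_{n+1}\in A_{e(\beta_n)}$ (and, for $n=0$, by the elements of the $A_l$), which are $k$-linear in each $a_l$ and are multiplied by concatenation and by the multiplications of the $A_l$. In other words, it is the tensor algebra over $A_{\mathcal A}=\prod_l A_l$ of the bimodule generated by the arrows. Let $I$ be a set of relations (linear combinations of paths of length at least $2$ with common start and common end) that generates an admissible ideal of $k\Gamma$. Let $\Lambda=k(\Gamma,\mathcal A,I)$ be the quotient of $k(\Gamma,\mathcal A)$ by the ideal generated by all elements $\sum_t\lambda_t\,\beta_{t1}\overline{\gamma_{t1}}\beta_{t2}\cdots\overline{\gamma_{t,m_t-1}}\beta_{tm_t}$,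 where $\sum_t\lambda_t\beta_{t1}\cdots\beta_{tm_t}\in I$ and $\gamma_{tl}$ is any path of $\Sigma_{e(\beta_{tl})}$, with class $\overline{\gamma_{tl}}$ in $A_{e(\beta_{tl})}$. Modules are right modules. Write $1_j$ for the identity of $A_j$, viewed in $\Lambda$. The representation of a $\Lambda$-module $N$ consists of the $A_j$-modules $N_j=N\cdot 1_j$ $(j\in\Gamma_0)$ and of the $k$-linear maps $\phi_\alpha:N_j\to N_{j'}$, $x\mapsto x\alpha$, for the arrows $\alpha:j\to j'$. Let $i\in\Gamma_0$ and let $M$ be a finitely generated $A_i$-module, with $k$-basis $(m_p)_p$. Regard $M$ as an $A_{\mathcal A}$-module through the component $A_i$. For each $l$ let $(a^l_c)_c$ be a $k$-basis of $A_l$. Let $((M_j)_j,(\phi_\alpha)_\alpha)$ be the representation of the cone $\mathcal C_i(M)=M\otimes_{A_{\mathcal A}}\Lambda$. For $j\ne i$ consider the formal sequences $$\sigma=m_p\,\gamma_1\,a^{s(\gamma_2)}_{i_2}\,\gamma_2\cdots a^{s(\gamma_r)}_{i_r}\,\gamma_r ,$$ where $r\ge 1$ and $\gamma_1\cdots\gamma_r$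 is a path from $i$ to $j$, and let $\overline\sigma=m_p\otimes\overline{\gamma_1a_{i_2}^{s(\gamma_2)}\gamma_2\cdots a_{i_r}^{s(\gamma_r)}\gamma_r}\in M_j$ be the class of $\sigma$. Then: 1. $m\mapsto m\otimes 1$ is an isomorphism $M\to M_i$ of $A_i$-modules. 2. If $j\neq i$, then $M_j$ is the free $A_j$-module on the classes of the formal sequences from $i$ to $j$, taken modulo the $k$-linear relations between them. That is, there are sets $S$ of formal sequences whose classes $(\overline\sigma)_{\sigma\in S}$ form a $k$-basis of the $k$-span of all the classes, and for every such $S$ the family $(\overline\sigma)_{\sigma\in S}$ is a basis of the $A_j$-module $M_j$. In particular, suppose that every element of $I$ is a nonzero scalar multiple of a path (for example $I=\emptyset$). Then $\overline\sigma=0$ for every $\sigma$ whose path $\gamma_1\cdots\gamma_r$ contains a path occurring in $I$ as a subpath, and the family of the classes of all the other formal sequences is a basis of the $A_j$-module $M_j$. 3. If $\alpha:j\to j'$ is an arrow with $j\ne i$, then $\phi_\alpha$ is the only $k$-linear map $M_j\to M_{j'}$ such that $$\phi_\alpha\bigl(\overline{m_p\gamma_1a_{i_2}^{s(\gamma_2)}\cdots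 a_{i_r}^{s(\gamma_r)}\gamma_r}\;a^j_c\bigr)=\overline{m_p\gamma_1a_{i_2}^{s(\gamma_2)}\cdots a_{i_r}^{s(\gamma_r)}\gamma_r\,a^j_c\,\alpha}$$ for all these formal sequences and all $c$. If $\alpha:i\to j'$ is an arrow, then $\phi_\alpha$ is the only $k$-linear map $M_i\to M_{j'}$ such that $\phi_\alpha(m_p\otimes 1)=\overline{m_p\alpha}$ for all $p$. -/

import Mathlib

open MulOpposite TensorProduct

noncomputable section

namespace GBP

universe u v w x

section Inclusion

variable {V : Type u} {A : V → Type x} [∀ i, Ring (A i)]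

/-- The inclusion of `A_i` in the product algebra `∏ A_l`; the idempotent `1_i` is `inc i 1`. -/
def inc (i : V) (a : A i) : ∀ l, A l :=
  open scoped Classical in Pi.single i a

theorem inc_mul (i : V) (a b : A i) : (inc i (a * b) : ∀ l, A l) = inc i a * inc i b := by
  classical
  unfold inc
  convert Pi.single_mul i a b

theorem inc_add (i : V) (a b : A i) : (inc i (a + b) : ∀ l, A l) = inc i a + inc i b := by
  classical
  unfold inc
  convert Pi.single_add i a b

theorem inc_zero (i : V) : (inc i (0 : A i) : ∀ l, A l) = 0 := by
  classical
  unfold inc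
  convert Pi.single_zero i

end Inclusion

/-! ### Generalized path algebras

Right modules over an algebra `R` are modules over `Rᵐᵒᵖ`, so `op r • x` is `x · r`.
Paths are composed from left to right. -/

section GeneralizedPathAlgebra

variable (k : Type w) [Field k] {V : Type u} [Quiver.{v} V] (A : V → Type x)
  [∀ i, Ring (A i)] [∀ i, Algebra k (A i)]

/-- The arrows of a quiver. -/
abbrev Arrow (V : Type u) [Quiver.{v} V] : Type (max u v) := Σ i j : V, (i ⟶ j)

/-- The free algebra on the elements of `A_𝒜 = ∏ A_i` and on the arrows. -/
abbrev FreeGPA : Type (max u v w x) := FreeAlgebra k ((∀ i, A i) ⊕ Arrow V)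

/-- The defining relations of the generalized path algebra: the elements of `∏ A_i`
multiply and add as they do there, and an arrow `α : i ⟶ j` satisfies `1_i α 1_j = α`. -/
inductive GPARel : FreeGPA k A → FreeGPA k A → Prop
  | add (a b : ∀ i, A i) : GPARel (FreeAlgebra.ι k (Sum.inl a) + FreeAlgebra.ι k (Sum.inl b))
      (FreeAlgebra.ι k (Sum.inl (a + b)))
  | mul (a b : ∀ i, A i) : GPARel (FreeAlgebra.ι k (Sum.inl a) * FreeAlgebra.ι k (Sum.inl b))
      (FreeAlgebra.ι k (Sum.inl (a * b)))
  | scalar (c : k) : GPARel (FreeAlgebra.ι k (Sum.inl (algebraMap k (∀ i, A i) c)))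
      (algebraMap k (FreeGPA k A) c)
  | arrow {i j : V} (α : i ⟶ j) : GPARel
      (FreeAlgebra.ι k (Sum.inl (inc i 1)) * FreeAlgebra.ι k (Sum.inr ⟨i, j, α⟩) *
        FreeAlgebra.ι k (Sum.inl (inc j 1)))
      (FreeAlgebra.ι k (Sum.inr ⟨i, j, α⟩))

/-- The generalized path algebra `k(Γ, 𝒜)` of a finite quiver: the tensor algebra over
`A_𝒜 = ∏ A_i` of the `A_𝒜`-bimodule generated by the arrows `α` subject to `1_{s(α)} α 1_{e(α)} = α`
(and with scalars acting alike on both sides). It is spanned by the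
`𝒜`-paths `a_1 β_1 a_2 ⋯ a_n β_n a_{n+1}`, which are `k`-linear in each `a_l` and are multiplied by
concatenation and by the multiplications of the `A_i`. -/
def GPA : Type (max u v w x) := RingQuot (GPARel k A)

instance : Ring (GPA k A) := inferInstanceAs (Ring (RingQuot (GPARel k A)))

instance : Algebra k (GPA k A) := inferInstanceAs (Algebra k (RingQuot (GPARel k A)))

/-- The quotient map from the free algebra. -/
def GPA.mk : FreeGPA k A →ₐ[k] GPA k A := RingQuot.mkAlgHom k (GPARel k A)

theorem GPA.mk_rel {a b : FreeGPA k A} (h : GPARel k A a b) : GPA.mk k A a = GPA.mk k A b :=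
  RingQuot.mkAlgHom_rel k h

/-- The algebra homomorphism from `A_𝒜 = ∏ A_i` to `k(Γ, 𝒜)`. -/
def GPA.base : (∀ i, A i) →ₐ[k] GPA k A where
  toFun a := GPA.mk k A (FreeAlgebra.ι k (Sum.inl a))
  map_one' := by
    have h := GPA.mk_rel k A (GPARel.scalar (1 : k))
    simpa using h
  map_mul' a b := by
    have h := GPA.mk_rel k A (GPARel.mul a b)
    rw [map_mul] at h
    exact h.symm
  map_zero' := by
    have h := GPA.mk_rel k A (GPARel.scalar (0 : k))
    simpa using h
  map_add' a b := by
    have h := GPA.mk_rel k A (GPARel.add a b)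
    rw [map_add] at h
    exact h.symm
  commutes' c := by
    have h := GPA.mk_rel k A (GPARel.scalar c)
    rw [AlgHom.commutes] at h
    exact h

/-- An arrow as an element of `k(Γ, 𝒜)`. -/
def GPA.arrow {i j : V} (α : i ⟶ j) : GPA k A := GPA.mk k A (FreeAlgebra.ι k (Sum.inr ⟨i, j, α⟩))

theorem GPA.base_mul_arrow {i j : V} (α : i ⟶ j) :
    GPA.base k A (inc i 1) * GPA.arrow k A α * GPA.base k A (inc j 1) = GPA.arrow k A α := by
  have h := GPA.mk_rel k A (GPARel.arrow α)
  rw [map_mul, map_mul] at h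
  exact h

end GeneralizedPathAlgebra

/-! ### Path algebras, relations and admissible ideals -/

section PathAlgebra

variable (k : Type w) [Field k] (Q : Type u) [Quiver.{v} Q]

/-- The ordinary path algebra `kQ`: every vertex carries the algebra `k`. -/
abbrev PathAlgebra : Type (max u v w) := GPA k (fun _ : Q => k)

variable {Q}

/-- A path as an element of the path algebra; the path of length `0` at `i` is `1_i`. -/
def pathElem : {i j : Q} → Quiver.Path i j → PathAlgebra k Q
  | i, _, .nil => GPA.base k (fun _ : Q => k) (inc i 1)
  | _, _, .cons p α => pathElem p * GPA.arrow k (fun _ : Q => k) α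

variable (Q) in
/-- The `m`-th power of the ideal of `kQ` generated by the arrows: the span of the paths of length
at least `m`. -/
def arrowIdealPow (m : ℕ) : Submodule k (PathAlgebra k Q) :=
  Submodule.span k {z | ∃ (i j : Q) (p : Quiver.Path i j), m ≤ p.length ∧ z = pathElem k p}

/-- An ideal `J` of `kQ` is admissible if `R ^ m ⊆ J ⊆ R ^ 2` for some `m ≥ 2`, where `R` is the
ideal generated by the arrows. -/
def IsAdmissible (J : TwoSidedIdeal (PathAlgebra k Q)) : Prop :=
  (∃ m : ℕ, 2 ≤ m ∧ ∀ z ∈ arrowIdealPow k Q m, z ∈ J) ∧ ∀ z ∈ J, z ∈ arrowIdealPow k Q 2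

variable (Q) in
/-- A relation: a linear combination of paths of length at least two with the same start and the
same end. -/
structure Relation where
  src : Q
  tgt : Q
  /-- the coefficients of the paths -/
  coeff : Quiver.Path src tgt →₀ k
  two_le : ∀ p ∈ coeff.support, 2 ≤ p.length

/-- A relation as an element of the path algebra. -/
def Relation.toElem {k : Type w} [Field k] {Q : Type u} [Quiver.{v} Q] (ρ : Relation k Q) :
    PathAlgebra k Q :=
  ρ.coeff.sum fun p c => c • pathElem k p

/-- The ideal of `kQ` generated by a set of relations. -/
def relationIdeal {k : Type w} [Field k] {Q : Type u} [Quiver.{v} Q] (I : Set (Relation k Q)) :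
    TwoSidedIdeal (PathAlgebra k Q) :=
  TwoSidedIdeal.span (Relation.toElem '' I)

/-- A quiver is acyclic if it has no oriented cycle. -/
def IsAcyclicQuiver (Q : Type u) [Quiver.{v} Q] : Prop :=
  ∀ (i : Q) (p : Quiver.Path i i), p.length = 0

/-- A presentation `A ≅ kΣ / Ω` of an algebra `A` by a finite quiver `Σ` and an admissible ideal
`Ω` of `kΣ`, the kernel of the surjection `kΣ → A`. Over an algebraically closed field, the algebras
that have one are the basic finite-dimensional ones. -/
structure BoundPresentation (k : Type w) [Field k] (A : Type x) [Ring A] [Algebra k A] where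
  /-- the vertices of `Σ` -/
  vertices : Type u
  [quiver : Quiver.{v} vertices]
  [finite_vertices : Finite vertices]
  [finite_arrows : ∀ a b : vertices, Finite (a ⟶ b)]
  /-- the surjection `kΣ → A` -/
  proj : PathAlgebra k vertices →ₐ[k] A
  surjective : Function.Surjective proj
  admissible : IsAdmissible k (TwoSidedIdeal.ker proj)

attribute [instance] BoundPresentation.quiver

end PathAlgebra

/-! ### Generalized bound path algebras -/

section Bound

universe u' v'

variable {k : Type w} [Field k] {V : Type u} [Quiver.{v} V] {A : V → Type x}
  [∀ i, Ring (A i)] [∀ i, Algebra k (A i)]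
  (P : ∀ i, BoundPresentation.{u', v'} k (A i))

/-- `IsInterleaving P p z`: for the path `p = β_1 ⋯ β_m`, `m ≥ 1`, of `Γ`, the element `z` of
`k(Γ, 𝒜)` is of the form `β_1 γ_1 β_2 ⋯ γ_{m-1} β_m`, where `γ_l` is (the class in `A_{e(β_l)}` of) a
path of the quiver `Σ_{e(β_l)}`. -/
inductive IsInterleaving : {i j : V} → Quiver.Path i j → GPA k A → Prop
  | single {i j : V} (β : i ⟶ j) : IsInterleaving (Quiver.Path.nil.cons β) (GPA.arrow k A β)
  | cons {i j l : V} (p : Quiver.Path i j) (z : GPA k A) (β : j ⟶ l)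
      {a b : (P j).vertices} (γ : Quiver.Path a b) (h : IsInterleaving p z) :
      IsInterleaving (p.cons β)
        (z * GPA.base k A (inc j ((P j).proj (pathElem k γ))) * GPA.arrow k A β)

/-- The set `𝒜(I)`: from each relation of `I` one gets its elements by interleaving each of its
paths with paths of the quivers `Σ_l`, chosen independently. -/
def boundSet (I : Set (Relation k V)) : Set (GPA k A) :=
  {z | ∃ ρ ∈ I, ∃ f : Quiver.Path ρ.src ρ.tgt → GPA k A,
    (∀ p ∈ ρ.coeff.support, IsInterleaving P p (f p)) ∧ z = ρ.coeff.sum fun p c => c • f p}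

variable (I : Set (Relation k V))

/-- The generalized bound path algebra `Λ = k(Γ, 𝒜, I)`: the quotient of `k(Γ, 𝒜)` by the ideal
generated by `𝒜(I)`. -/
def BoundGPA : Type (max u v w x) := RingQuot fun y z : GPA k A => y ∈ boundSet P I ∧ z = 0

instance : Ring (BoundGPA P I) :=
  inferInstanceAs (Ring (RingQuot fun y z : GPA k A => y ∈ boundSet P I ∧ z = 0))

instance : Algebra k (BoundGPA P I) :=
  inferInstanceAs (Algebra k (RingQuot fun y z : GPA k A => y ∈ boundSet P I ∧ z = 0))

/-- The quotient map `k(Γ, 𝒜) → Λ`. -/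
def BoundGPA.mk : GPA k A →ₐ[k] BoundGPA P I :=
  RingQuot.mkAlgHom k fun y z : GPA k A => y ∈ boundSet P I ∧ z = 0

/-- The algebra homomorphism from `A_𝒜 = ∏ A_i` to `Λ`. -/
def BoundGPA.base : (∀ i, A i) →ₐ[k] BoundGPA P I := (BoundGPA.mk P I).comp (GPA.base k A)

/-- The element of `Λ` given by an element of `A_i`. -/
def BoundGPA.elem (i : V) (a : A i) : BoundGPA P I := BoundGPA.base P I (inc i a)

/-- The element of `Λ` given by an arrow. -/
def BoundGPA.arrow {i j : V} (α : i ⟶ j) : BoundGPA P I := BoundGPA.mk P I (GPA.arrow k A α)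

theorem BoundGPA.elem_mul (i : V) (a b : A i) :
    BoundGPA.elem P I i (a * b) = BoundGPA.elem P I i a * BoundGPA.elem P I i b := by
  rw [elem, inc_mul, map_mul]; rfl

theorem BoundGPA.elem_add (i : V) (a b : A i) :
    BoundGPA.elem P I i (a + b) = BoundGPA.elem P I i a + BoundGPA.elem P I i b := by
  rw [elem, inc_add, map_add]; rfl

theorem BoundGPA.elem_zero (i : V) : BoundGPA.elem P I i 0 = 0 := by
  rw [elem, inc_zero, map_zero]

theorem BoundGPA.arrow_mul_elem {i j : V} (α : i ⟶ j) :
    BoundGPA.arrow P I α * BoundGPA.elem P I j 1 = BoundGPA.arrow P I α := by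
  have hi : GPA.base k A (inc j 1) * GPA.base k A (inc j 1) = GPA.base k A (inc j 1) := by
    rw [← map_mul, ← inc_mul, one_mul]
  have h : GPA.arrow k A α * GPA.base k A (inc j 1) = GPA.arrow k A α := by
    conv_lhs => rw [← GPA.base_mul_arrow k A α]
    rw [mul_assoc, hi, GPA.base_mul_arrow]
  change BoundGPA.mk P I (GPA.arrow k A α) * BoundGPA.mk P I (GPA.base k A (inc j 1)) =
    BoundGPA.mk P I (GPA.arrow k A α)
  rw [← map_mul, h]

/-! ### The representation of a `Λ`-module -/

section Representation

variable (N : Type*) [AddCommGroup N] [Module k N] [Module (BoundGPA P I)ᵐᵒᵖ N]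
  [IsScalarTower k (BoundGPA P I)ᵐᵒᵖ N]

/-- The subspace `N · 1_j` of a right `Λ`-module `N`. -/
def vertexSpace (j : V) : Submodule k N where
  carrier := {x | ∃ y : N, op (BoundGPA.elem P I j 1) • y = x}
  add_mem' := by
    rintro _ _ ⟨y, rfl⟩ ⟨z, rfl⟩
    exact ⟨y + z, smul_add _ _ _⟩
  zero_mem' := ⟨0, smul_zero _⟩
  smul_mem' := by
    rintro c _ ⟨y, rfl⟩
    exact ⟨c • y, smul_algebra_smul_comm _ _ _⟩

/-- The right `A_j`-module `N_j = N · 1_j` at the vertex `j` of the representation of `N`. -/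
def VertexModule (j : V) : Type _ := vertexSpace P I N j

variable {N}

theorem smul_elem_mem (j : V) (a : A j) (y : N) :
    op (BoundGPA.elem P I j a) • y ∈ vertexSpace P I N j :=
  ⟨op (BoundGPA.elem P I j a) • y, by
    rw [← mul_smul, ← op_mul, ← BoundGPA.elem_mul, mul_one]⟩

theorem smul_arrow_mem {i j : V} (α : i ⟶ j) (y : N) :
    op (BoundGPA.arrow P I α) • y ∈ vertexSpace P I N j :=
  ⟨op (BoundGPA.arrow P I α) • y, by
    rw [← mul_smul, ← op_mul, BoundGPA.arrow_mul_elem]⟩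

theorem elem_one_smul (j : V) (y : vertexSpace P I N j) :
    op (BoundGPA.elem P I j 1) • (y : N) = y := by
  obtain ⟨_, z, rfl⟩ := y
  change op (BoundGPA.elem P I j 1) • (op (BoundGPA.elem P I j 1) • z) = _
  rw [← mul_smul, ← op_mul, ← BoundGPA.elem_mul, mul_one]

variable (N)

instance (j : V) : AddCommGroup (VertexModule P I N j) :=
  inferInstanceAs (AddCommGroup (vertexSpace P I N j))

instance (j : V) : Module k (VertexModule P I N j) :=
  inferInstanceAs (Module k (vertexSpace P I N j))

variable {N}

/-- The inclusion of `N_j = N · 1_j` in `N`. -/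
def VertexModule.val (j : V) : VertexModule P I N j →ₗ[k] N := (vertexSpace P I N j).subtype

instance (j : V) : Module (A j)ᵐᵒᵖ (VertexModule P I N j) where
  smul a y := (⟨op (BoundGPA.elem P I j a.unop) • VertexModule.val P I j y,
    smul_elem_mem P I j a.unop _⟩ : vertexSpace P I N j)
  one_smul y := Subtype.ext (elem_one_smul P I j y)
  mul_smul a b y := Subtype.ext (by
    change op (BoundGPA.elem P I j (b.unop * a.unop)) • VertexModule.val P I j y =
      op (BoundGPA.elem P I j a.unop) • op (BoundGPA.elem P I j b.unop) • VertexModule.val P I j y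
    rw [BoundGPA.elem_mul, op_mul, mul_smul])
  smul_zero a := Subtype.ext (smul_zero (op (BoundGPA.elem P I j a.unop)))
  smul_add a y z := Subtype.ext (smul_add (op (BoundGPA.elem P I j a.unop))
    (VertexModule.val P I j y) (VertexModule.val P I j z))
  add_smul a b y := Subtype.ext (by
    change op (BoundGPA.elem P I j (a.unop + b.unop)) • VertexModule.val P I j y =
      op (BoundGPA.elem P I j a.unop) • VertexModule.val P I j y +
      op (BoundGPA.elem P I j b.unop) • VertexModule.val P I j y
    rw [BoundGPA.elem_add, op_add, add_smul])
  zero_smul y := Subtype.ext (by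
    change op (BoundGPA.elem P I j 0) • VertexModule.val P I j y = 0
    rw [BoundGPA.elem_zero, op_zero, zero_smul])

/-- The linear map `φ_α : N_i → N_j`, `x ↦ x · α`, at the arrow `α : i ⟶ j` of the representation
of `N`. -/
def arrowMap {i j : V} (α : i ⟶ j) : VertexModule P I N i →ₗ[k] VertexModule P I N j where
  toFun y := (⟨op (BoundGPA.arrow P I α) • VertexModule.val P I i y,
    smul_arrow_mem P I α _⟩ : vertexSpace P I N j)
  map_add' y z := Subtype.ext (smul_add (op (BoundGPA.arrow P I α))
    (VertexModule.val P I i y) (VertexModule.val P I i z))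
  map_smul' c y := Subtype.ext (smul_algebra_smul_comm c (op (BoundGPA.arrow P I α))
    (VertexModule.val P I i y))

end Representation

/-! ### Cones -/

section Cone

variable (i : V) (M : Type*) [AddCommGroup M] [Module k M] [Module (A i)ᵐᵒᵖ M]

/-- The relations `(m · a) ⊗ l = m ⊗ (a l)` of the tensor product over `A_𝒜 = ∏ A_l`, which acts on
`M` through its component `A_i`. The two factors are written in the order `l ⊗ m`, so that the right
action of `Λ` on the first factor is the one that Mathlib puts on `Λ ⊗[k] M`. -/
def coneRelations : Submodule (BoundGPA P I)ᵐᵒᵖ (BoundGPA P I ⊗[k] M) :=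
  Submodule.span _ {t | ∃ (m : M) (a : ∀ l, A l) (l : BoundGPA P I),
    t = l ⊗ₜ[k] (op (a i) • m) - (BoundGPA.base P I a * l) ⊗ₜ[k] m}

/-- The cone `𝒞_i(M) = M ⊗_{A_𝒜} Λ`, a right `Λ`-module. -/
def Cone : Type _ := (BoundGPA P I ⊗[k] M) ⧸ coneRelations P I i M

instance : AddCommGroup (Cone P I i M) :=
  inferInstanceAs (AddCommGroup ((BoundGPA P I ⊗[k] M) ⧸ coneRelations P I i M))

instance : Module (BoundGPA P I)ᵐᵒᵖ (Cone P I i M) :=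
  inferInstanceAs (Module (BoundGPA P I)ᵐᵒᵖ ((BoundGPA P I ⊗[k] M) ⧸ coneRelations P I i M))

instance : Module k (Cone P I i M) :=
  inferInstanceAs (Module k ((BoundGPA P I ⊗[k] M) ⧸ coneRelations P I i M))

instance : IsScalarTower k (BoundGPA P I)ᵐᵒᵖ (Cone P I i M) :=
  inferInstanceAs (IsScalarTower k (BoundGPA P I)ᵐᵒᵖ
    ((BoundGPA P I ⊗[k] M) ⧸ coneRelations P I i M))

variable {M}

/-- The element `m ⊗ l` of the cone. -/
def Cone.tmul (m : M) (l : BoundGPA P I) : Cone P I i M :=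
  Submodule.Quotient.mk (p := coneRelations P I i M) (l ⊗ₜ[k] m)

end Cone

/-! ### Formal sequences -/

/-- `Word κ i j`: the formal sequences `γ_1 a_2 γ_2 ⋯ a_r γ_r`, `r ≥ 1`, where `γ_1 ⋯ γ_r` is a path
from `i` to `j` and `a_l` is an index in `κ (s(γ_l))`; here `κ l` indexes a basis of `A_l`. -/
inductive Word (κ : V → Type*) (i : V) : V → Type _
  | single {j : V} (α : i ⟶ j) : Word κ i j
  | snoc {j l : V} (s : Word κ i j) (c : κ j) (α : j ⟶ l) : Word κ i l

/-- The path `γ_1 ⋯ γ_r` that underlies a formal sequence. -/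
def Word.path {κ : V → Type*} {i : V} : {j : V} → Word κ i j → Quiver.Path i j
  | _, .single α => Quiver.Path.nil.cons α
  | _, .snoc s _ α => s.path.cons α

/-- The class of a formal sequence in `Λ`. -/
def Word.elem {κ : V → Type*} (b : ∀ l, Module.Basis (κ l) k (A l)) {i : V} :
    {j : V} → Word κ i j → BoundGPA P I
  | _, .single α => BoundGPA.arrow P I α
  | _, .snoc (j := j) s c α => s.elem b * BoundGPA.elem P I j (b j c) * BoundGPA.arrow P I α

theorem Word.elem_mul_one {κ : V → Type*} (b : ∀ l, Module.Basis (κ l) k (A l)) {i j : V}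
    (s : Word κ i j) : s.elem P I b * BoundGPA.elem P I j 1 = s.elem P I b := by
  cases s with
  | single α => exact BoundGPA.arrow_mul_elem P I α
  | snoc s c α => rw [Word.elem, mul_assoc, BoundGPA.arrow_mul_elem]

/-- The class `m_p γ_1 a_2 γ_2 ⋯ a_r γ_r` of a formal sequence in `𝒞_i(M)_j = 𝒞_i(M) · 1_j`. -/
def seqClass {κ : V → Type*} (b : ∀ l, Module.Basis (κ l) k (A l)) {i : V} {M : Type*}
    [AddCommGroup M] [Module k M] [Module (A i)ᵐᵒᵖ M] {τ : Type*} (μ : Module.Basis τ k M) {j : V}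
    (s : τ × Word κ i j) : VertexModule P I (Cone P I i M) j :=
  (⟨Cone.tmul P I i (μ s.1) (s.2.elem P I b), Cone.tmul P I i (μ s.1) (s.2.elem P I b), by
    change Submodule.Quotient.mk (op (BoundGPA.elem P I j 1) • (s.2.elem P I b ⊗ₜ[k] μ s.1)) = _
    rw [TensorProduct.smul_tmul', op_smul_eq_mul, Word.elem_mul_one]
    rfl⟩ : vertexSpace P I (Cone P I i M) j)

/-- The path `p` has a subpath that belongs to a relation of `I` (with a nonzero coefficient). -/
def ContainsRelationPath (I : Set (Relation k V)) {i j : V} (p : Quiver.Path i j) : Prop :=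
  ∃ ρ ∈ I, ∃ q ∈ ρ.coeff.support, ∃ (y : Quiver.Path i ρ.src) (z : Quiver.Path ρ.tgt j),
    p = (y.comp q).comp z

/-- Every relation of `I` is a nonzero scalar multiple of a path. -/
def IsMonomial (I : Set (Relation k V)) : Prop :=
  ∀ ρ ∈ I, ∃ (q : Quiver.Path ρ.src ρ.tgt) (c : k), c ≠ 0 ∧ ρ.coeff = Finsupp.single q c

end Bound

end GBP

end

/-! Generation is direct. The elements `m ⊗ 1`, together with the classes of formal sequences
followed by one last coefficient, span a subspace of the cone that is stable under the base algebra
and under the arrows, hence the whole cone. At `j ≠ i` the part `M · 1_j` vanishes, so the classes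
generate the component over `A_j`. At `i` acyclicity excludes formal sequences, so only `M` remains.

Freeness holds because the defining relations of `Λ` end in arrows and so impose nothing on the last
coefficient. To make this precise, `Cone.exists_map_model` lets `Λ` act on `M × (W ⊗ ∏ A_l)`: the
base algebra multiplies the last coefficient, while an arrow `α` absorbs the whole vector into `W`
and restarts with the coefficient `1` at its end. The vectors `(m, 0)` then define a map from the
cone. The model is used twice.

With `W` the cone itself, an arrow evaluates the vector in the cone and multiplies the value by `α`.
A relation then acts through its class in `Λ`, which is zero. The resulting map
(`Cone.exists_embedding`) sends `x α a` to `xα ⊗ a`, so classes independent over `k` are independent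
over `A_j` (`linearIndependent_of_tmul`); its first component recovers `m` from `m ⊗ 1`.

With `W` the space of formal sequences, where a result is replaced by zero as soon as it contains a
path of a relation, `exists_map_words` sends the remaining sequences to distinct basis vectors. For
monomial relations the other sequences vanish in the cone (`Word.elem_eq_zero`), because each
coefficient in `A_l` is a combination of classes of paths of `Σ_l`. -/

namespace GBP

/-! ### Components and idempotents of the product algebra -/

section Inclusion

variable {V : Type*} {A : V → Type*} [∀ i, Ring (A i)]

theorem inc_same (i : V) (a : A i) : inc i a i = a := by
  classical
  unfold inc
  convert Pi.single_eq_same i a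

theorem inc_ne {i j : V} (h : j ≠ i) (a : A i) : inc i a j = 0 := by
  classical
  unfold inc
  convert Pi.single_eq_of_ne h a

theorem inc_mul_pi (i : V) (a : A i) (x : ∀ l, A l) : inc i a * x = inc i (a * x i) := by
  funext j
  by_cases h : j = i
  · subst h
    simp [inc_same]
  · simp [inc_ne h]

theorem inc_smul {k : Type*} [Field k] [∀ i, Algebra k (A i)] (i : V) (c : k) (a : A i) :
    (inc i (c • a) : ∀ l, A l) = c • inc i a := by
  funext j
  by_cases h : j = i
  · subst h
    simp [inc_same]
  · simp [inc_ne h]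

theorem inc_mul_inc_of_ne {i j : V} (h : i ≠ j) (a : A i) (b : A j) :
    (inc i a : ∀ l, A l) * inc j b = 0 := by
  rw [inc_mul_pi, inc_ne h, mul_zero, inc_zero]

theorem sum_inc [Fintype V] (x : ∀ l, A l) : ∑ l, inc l (x l) = x := by
  funext j
  rw [Finset.sum_apply, Finset.sum_eq_single j, inc_same]
  · intro l _ h
    exact inc_ne h.symm _
  · simp

variable (A) in
/-- The inclusion of `A_i` in the product algebra as a linear map. -/
noncomputable def incLinear (k : Type*) [Field k] [∀ i, Algebra k (A i)] (i : V) :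
    A i →ₗ[k] ∀ l, A l where
  toFun := inc i
  map_add' := inc_add i
  map_smul' := inc_smul i

end Inclusion

/-! ### Generators and universal property of the generalized path algebra -/

section GeneralizedPathAlgebra

variable {k : Type*} [Field k] {V : Type*} [Quiver V] {A : V → Type*}
  [∀ i, Ring (A i)] [∀ i, Algebra k (A i)]

theorem GPA.mk_surjective : Function.Surjective (GPA.mk k A) :=
  RingQuot.mkAlgHom_surjective k (GPARel k A)

/-- The generalized path algebra is generated by `∏ A_l` and the arrows. -/
theorem GPA.induction {C : GPA k A → Prop} (base : ∀ a, C (GPA.base k A a))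
    (arrow : ∀ {i j : V} (α : i ⟶ j), C (GPA.arrow k A α))
    (mul : ∀ x y, C x → C y → C (x * y)) (add : ∀ x y, C x → C y → C (x + y)) (x : GPA k A) :
    C x := by
  obtain ⟨y, rfl⟩ := GPA.mk_surjective x
  induction y using FreeAlgebra.induction with
  | grade0 c =>
    rw [AlgHom.commutes, ← AlgHom.commutes (GPA.base k A)]
    exact base _
  | grade1 g =>
    rcases g with a | ⟨i, j, α⟩
    · exact base a
    · exact arrow α
  | mul x y hx hy => rw [map_mul]; exact mul _ _ hx hy
  | add x y hx hy => rw [map_add]; exact add _ _ hx hy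

theorem GPA.arrow_mul_inc {i j : V} (α : i ⟶ j) :
    GPA.arrow k A α * GPA.base k A (inc j 1) = GPA.arrow k A α := by
  conv_lhs => rw [← GPA.base_mul_arrow k A α]
  rw [mul_assoc, ← map_mul, ← inc_mul, one_mul, GPA.base_mul_arrow]

theorem GPA.inc_mul_arrow {i j : V} (α : i ⟶ j) :
    GPA.base k A (inc i 1) * GPA.arrow k A α = GPA.arrow k A α := by
  conv_lhs => rw [← GPA.base_mul_arrow k A α]
  rw [← mul_assoc, ← mul_assoc, ← map_mul, ← inc_mul, one_mul, GPA.base_mul_arrow]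

/-- The universal property of the generalized path algebra. -/
theorem GPA.exists_lift {R : Type*} [Ring R] [Algebra k R] (ρ : (∀ l, A l) →ₐ[k] R)
    (g : ∀ {i j : V}, (i ⟶ j) → R)
    (hg : ∀ {i j : V} (α : i ⟶ j), ρ (inc i 1) * g α * ρ (inc j 1) = g α) :
    ∃ Ψ : GPA k A →ₐ[k] R, (∀ a, Ψ (GPA.base k A a) = ρ a) ∧
      ∀ {i j : V} (α : i ⟶ j), Ψ (GPA.arrow k A α) = g α := by
  let L : FreeGPA k A →ₐ[k] R := FreeAlgebra.lift k (Sum.elim ρ fun α => g α.2.2)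
  have hL : ∀ ⦃x y : FreeGPA k A⦄, GPARel k A x y → L x = L y := by
    intro x y h
    cases h with
    | add a b => simp [L]
    | mul a b => simp [L]
    | scalar c => simp [L]
    | arrow α => simpa [L] using hg α
  refine ⟨RingQuot.liftAlgHom k ⟨L, hL⟩, fun a => ?_, fun {i j} α => ?_⟩
  · refine (RingQuot.liftAlgHom_mkAlgHom_apply k L hL _).trans ?_
    simp [L]
  · refine (RingQuot.liftAlgHom_mkAlgHom_apply k L hL _).trans ?_
    simp [L]

end GeneralizedPathAlgebra

/-! ### Path algebras are spanned by paths -/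

section PathAlgebra

variable {k : Type*} [Field k] {Q : Type*} [Quiver Q]

theorem pathElem_mul_inc {i j : Q} (p : Quiver.Path i j) :
    pathElem k p * GPA.base k (fun _ : Q => k) (inc j 1) = pathElem k p := by
  cases p with
  | nil => rw [pathElem, ← map_mul, ← inc_mul, one_mul]
  | cons p α => rw [pathElem, mul_assoc, GPA.arrow_mul_inc]

variable (k) in
/-- The path algebra of a quiver with finitely many vertices is spanned by the paths. -/
theorem span_pathElem [Finite Q] :
    Submodule.span k {z : PathAlgebra k Q | ∃ (i j : Q) (p : Quiver.Path i j), z = pathElem k p} =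
      ⊤ := by
  have := Fintype.ofFinite Q
  set T := Submodule.span k
    {z : PathAlgebra k Q | ∃ (i j : Q) (p : Quiver.Path i j), z = pathElem k p} with hT
  have hone : (1 : PathAlgebra k Q) ∈ T := by
    rw [← map_one (GPA.base k (fun _ : Q => k)), ← sum_inc (1 : Q → k), map_sum]
    exact Submodule.sum_mem _ fun l _ =>
      Submodule.subset_span ⟨l, l, .nil, by rw [pathElem, Pi.one_apply]⟩
  -- The span contains `1` and is stable under right multiplication by generators, so it is
  -- everything.
  have key : ∀ x : PathAlgebra k Q, ∀ t ∈ T, t * x ∈ T := by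
    have red : ∀ x : PathAlgebra k Q,
        (∀ (i j : Q) (p : Quiver.Path i j), pathElem k p * x ∈ T) → ∀ t ∈ T, t * x ∈ T := by
      intro x hx t ht
      induction ht using Submodule.span_induction with
      | mem t ht => obtain ⟨i, j, p, rfl⟩ := ht; exact hx i j p
      | zero => rw [zero_mul]; exact T.zero_mem
      | add y z _ _ hy hz => rw [add_mul]; exact T.add_mem hy hz
      | smul c y _ hy => rw [smul_mul_assoc]; exact T.smul_mem c hy
    intro x
    induction x using GPA.induction with
    | base a =>
      refine red _ fun i j p => ?_
      -- Here every vertex algebra is `k`, so a base element multiplies a path by a scalar, its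
      -- component at the end of the path.
      have : (inc j (a j) : Q → k) = a j • inc j 1 := by rw [← inc_smul, smul_eq_mul, mul_one]
      rw [← pathElem_mul_inc, mul_assoc, ← map_mul, inc_mul_pi, one_mul, this, map_smul,
        mul_smul_comm, pathElem_mul_inc]
      exact T.smul_mem _ (Submodule.subset_span ⟨i, j, p, rfl⟩)
    | arrow α =>
      rename_i j' l
      refine red _ fun i j p => ?_
      by_cases h : j = j'
      · subst h
        exact Submodule.subset_span ⟨i, l, p.cons α, by rw [pathElem]⟩
      · rw [← pathElem_mul_inc, ← GPA.inc_mul_arrow, mul_assoc, ← mul_assoc (GPA.base k _ _),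
          ← map_mul, inc_mul_inc_of_ne h, map_zero, zero_mul, mul_zero]
        exact T.zero_mem
    | mul x y hx hy =>
      intro t ht
      rw [← mul_assoc]
      exact hy _ (hx _ ht)
    | add x y hx hy =>
      intro t ht
      rw [mul_add]
      exact T.add_mem (hx _ ht) (hy _ ht)
  exact eq_top_iff.2 fun x _ => by simpa using key x 1 hone

/-- An algebra with a bound presentation is spanned by the classes of the paths. -/
theorem BoundPresentation.span_proj {A : Type*} [Ring A] [Algebra k A]
    (P : BoundPresentation k A) :
    Submodule.span k {x : A | ∃ (a b : P.vertices) (γ : Quiver.Path a b),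
      x = P.proj (pathElem k γ)} = ⊤ := by
  have := P.finite_vertices
  have h := congrArg (Submodule.map P.proj.toLinearMap) (span_pathElem k (Q := P.vertices))
  rw [Submodule.map_span, Submodule.map_top, LinearMap.range_eq_top.2 P.surjective] at h
  rw [← h]
  congr 1
  ext x
  constructor
  · rintro ⟨a, b, γ, rfl⟩
    exact ⟨_, ⟨a, b, γ, rfl⟩, rfl⟩
  · rintro ⟨_, ⟨a, b, γ, rfl⟩, rfl⟩
    exact ⟨a, b, γ, rfl⟩

end PathAlgebra

/-! ### Universal properties of `Λ` and of the cone -/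

section Bound

variable {k : Type*} [Field k] {V : Type*} [Quiver V] {A : V → Type*}
  [∀ i, Ring (A i)] [∀ i, Algebra k (A i)]
  (P : ∀ i, BoundPresentation k (A i)) (I : Set (Relation k V))

theorem BoundGPA.mk_surjective : Function.Surjective (BoundGPA.mk P I) :=
  RingQuot.mkAlgHom_surjective k _

theorem BoundGPA.mk_eq_zero {z : GPA k A} (hz : z ∈ boundSet P I) : BoundGPA.mk P I z = 0 := by
  have h : BoundGPA.mk P I z = BoundGPA.mk P I 0 :=
    RingQuot.mkAlgHom_rel k (s := fun y z : GPA k A => y ∈ boundSet P I ∧ z = 0) ⟨hz, rfl⟩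
  rw [h, map_zero]

theorem BoundGPA.exists_lift {R : Type*} [Ring R] [Algebra k R] (Ψ : GPA k A →ₐ[k] R)
    (h : ∀ z ∈ boundSet P I, Ψ z = 0) :
    ∃ Φ : BoundGPA P I →ₐ[k] R, ∀ z, Φ (BoundGPA.mk P I z) = Ψ z := by
  have hΨ : ∀ ⦃x y : GPA k A⦄, (x ∈ boundSet P I ∧ y = 0) → Ψ x = Ψ y := by
    rintro x _ ⟨hx, rfl⟩
    rw [h x hx, map_zero]
  exact ⟨RingQuot.liftAlgHom k ⟨Ψ, hΨ⟩, RingQuot.liftAlgHom_mkAlgHom_apply k Ψ hΨ⟩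

theorem BoundGPA.elem_one_mul_arrow {i j : V} (α : i ⟶ j) :
    BoundGPA.elem P I i 1 * BoundGPA.arrow P I α = BoundGPA.arrow P I α := by
  change BoundGPA.mk P I (GPA.base k A (inc i 1)) * BoundGPA.mk P I (GPA.arrow k A α) = _
  rw [← map_mul, GPA.inc_mul_arrow]
  rfl

theorem BoundGPA.elem_mul_base (i : V) (a : A i) (x : ∀ l, A l) :
    BoundGPA.elem P I i a * BoundGPA.base P I x = BoundGPA.elem P I i (a * x i) := by
  rw [elem, ← map_mul, inc_mul_pi]
  rfl

theorem BoundGPA.elem_mul_arrow_of_ne {i j l : V} (h : i ≠ j) (a : A i) (α : j ⟶ l) :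
    BoundGPA.elem P I i a * BoundGPA.arrow P I α = 0 := by
  rw [← elem_one_mul_arrow, ← mul_assoc, elem, elem, ← map_mul, inc_mul_inc_of_ne h, map_zero,
    zero_mul]

/-- The inclusion of `A_i` in `Λ` as a linear map. -/
noncomputable def BoundGPA.elemLinear (i : V) : A i →ₗ[k] BoundGPA P I :=
  (BoundGPA.base P I).toLinearMap ∘ₗ incLinear A k i

theorem BoundGPA.elemLinear_apply (i : V) (a : A i) :
    BoundGPA.elemLinear P I i a = BoundGPA.elem P I i a := rfl

section Representation

variable {N : Type*} [AddCommGroup N] [Module k N] [Module (BoundGPA P I)ᵐᵒᵖ N]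
  [IsScalarTower k (BoundGPA P I)ᵐᵒᵖ N]

theorem VertexModule.val_injective (j : V) : Function.Injective (VertexModule.val P I (N := N) j) :=
  Subtype.val_injective

theorem VertexModule.val_smul (j : V) (a : (A j)ᵐᵒᵖ) (y : VertexModule P I N j) :
    VertexModule.val P I j (a • y) =
      op (BoundGPA.elem P I j a.unop) • VertexModule.val P I j y := rfl

theorem VertexModule.val_arrowMap {i j : V} (α : i ⟶ j) (y : VertexModule P I N i) :
    VertexModule.val P I j (arrowMap P I α y) =
      op (BoundGPA.arrow P I α) • VertexModule.val P I i y := rfl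

theorem VertexModule.val_mem (j : V) (y : VertexModule P I N j) :
    op (BoundGPA.elem P I j 1) • VertexModule.val P I j y = VertexModule.val P I j y :=
  elem_one_smul P I j y

/-- The scalar `c` acts through `c · 1_j`, and `1_j` fixes `N · 1_j`. This allows spans over `k` to
be compared with spans over `A_j`. -/
instance (j : V) : IsScalarTower k (A j)ᵐᵒᵖ (VertexModule P I N j) :=
  .of_algebraMap_smul fun c y => by
    apply VertexModule.val_injective P I
    have h : BoundGPA.elem P I j (algebraMap k (A j) c) = c • BoundGPA.elem P I j 1 := by
      rw [← BoundGPA.elemLinear_apply, Algebra.algebraMap_eq_smul_one, map_smul]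
      rfl
    rw [VertexModule.val_smul, map_smul, MulOpposite.algebraMap_apply, unop_op, h, op_smul,
      smul_assoc, VertexModule.val_mem]

end Representation

section Cone

variable (i : V) {M : Type*} [AddCommGroup M] [Module k M] [Module (A i)ᵐᵒᵖ M]

variable (M) in
/-- The map `(m, l) ↦ m ⊗ l` as a bilinear map. -/
noncomputable def Cone.tmulHom : M →ₗ[k] BoundGPA P I →ₗ[k] Cone P I i M :=
  LinearMap.mk₂ k (Cone.tmul P I i)
    (fun m n l => congrArg (Submodule.Quotient.mk (p := coneRelations P I i M)) (tmul_add l m n))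
    (fun c m l => congrArg (Submodule.Quotient.mk (p := coneRelations P I i M)) (tmul_smul c l m))
    (fun m l l' => congrArg (Submodule.Quotient.mk (p := coneRelations P I i M)) (add_tmul l l' m))
    (fun c m l => congrArg (Submodule.Quotient.mk (p := coneRelations P I i M))
      (smul_tmul' c l m).symm)

theorem Cone.tmulHom_apply (m : M) (l : BoundGPA P I) :
    Cone.tmulHom P I i M m l = Cone.tmul P I i m l := rfl

theorem Cone.op_smul_tmul (m : M) (l l' : BoundGPA P I) :
    op l' • Cone.tmul P I i m l = Cone.tmul P I i m (l * l') := rfl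

theorem Cone.tmul_base_mul (m : M) (a : ∀ l, A l) (l : BoundGPA P I) :
    Cone.tmul P I i m (BoundGPA.base P I a * l) = Cone.tmul P I i (op (a i) • m) l :=
  ((Submodule.Quotient.eq (coneRelations P I i M)).2 
    (Submodule.subset_span ⟨m, a, l, rfl⟩)).symm

theorem Cone.span_tmul :
    Submodule.span k {x | ∃ (m : M) (l : BoundGPA P I), x = Cone.tmul P I i m l} = ⊤ := by
  refine eq_top_iff.2 fun x _ => ?_
  obtain ⟨t, rfl⟩ := Submodule.Quotient.mk_surjective (coneRelations P I i M) x
  induction t with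
  | zero => exact Submodule.zero_mem _
  | tmul l m => exact Submodule.subset_span ⟨m, l, rfl⟩
  | add x y hx hy => exact Submodule.add_mem _ (hx trivial) (hy trivial)

/-- The universal property of the cone. -/
theorem Cone.exists_lift {N : Type*} [AddCommGroup N] [Module k N]
    (Φ : BoundGPA P I →ₐ[k] (Module.End k N)ᵐᵒᵖ) (ι : M →ₗ[k] N)
    (h : ∀ m a, (Φ (BoundGPA.base P I a)).unop (ι m) = ι (op (a i) • m)) :
    ∃ θ : Cone P I i M →ₗ[k] N, ∀ m l, θ (Cone.tmul P I i m l) = (Φ l).unop (ι m) := by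
  let β : BoundGPA P I →ₗ[k] M →ₗ[k] N :=
    LinearMap.mk₂ k (fun l m => (Φ l).unop (ι m)) (by simp) (by simp) (by simp) (by simp)
  let B : BoundGPA P I ⊗[k] M →ₗ[k] N := TensorProduct.lift β
  have hB : ∀ l m, B (l ⊗ₜ m) = (Φ l).unop (ι m) := fun l m => rfl
  -- `coneRelations` is a span over the opposite of `Λ`, not over `k`: to vanish on it, `B` has to
  -- intertwine the actions of `Λ`.
  have hsmul : ∀ (l : BoundGPA P I) t, B (op l • t) = (Φ l).unop (B t) := by
    intro l t
    induction t with
    | zero => simp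
    | tmul l' m =>
      rw [TensorProduct.smul_tmul', op_smul_eq_mul, hB, hB, map_mul, unop_mul]
      rfl
    | add x y hx hy => rw [smul_add, map_add, map_add, map_add, hx, hy]
  have hker : (coneRelations P I i M).restrictScalars k ≤ LinearMap.ker B := by
    intro t ht
    rw [Submodule.restrictScalars_mem] at ht
    rw [LinearMap.mem_ker]
    induction ht using Submodule.span_induction with
    | mem t ht =>
      obtain ⟨m, a, l, rfl⟩ := ht
      rw [map_sub, hB, hB, map_mul, unop_mul, ← h]
      exact sub_self _
    | zero => exact map_zero _
    | add x y _ _ hx hy => rw [map_add, hx, hy, add_zero]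
    | smul l x _ hx => rw [← op_unop l, hsmul, hx, map_zero]
  exact ⟨Submodule.liftQ _ B hker ∘ₗ
    (Submodule.Quotient.restrictScalarsEquiv k (coneRelations P I i M)).symm.toLinearMap,
    fun m l => hB l m⟩

end Cone

end Bound

/-! ### The base algebra acting on the last coefficient -/

section BaseAction

variable {k : Type*} [Field k] {V : Type*} {A : V → Type*}
  [∀ i, Ring (A i)] [∀ i, Algebra k (A i)]
  (i : V) (M : Type*) [AddCommGroup M] [Module k M] [Module (A i)ᵐᵒᵖ M]
  [IsScalarTower k (A i)ᵐᵒᵖ M] (W : Type*) [AddCommGroup W] [Module k W]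

variable (A) in
/-- The right action of `∏ A_l` on `M × (W ⊗ ∏ A_l)`. -/
noncomputable def baseAction :
    (∀ l, A l) →ₐ[k] (Module.End k (M × (W ⊗[k] ∀ l, A l)))ᵐᵒᵖ where
  toFun a := op (LinearMap.prodMap (Algebra.lsmul k k M (op (a i)))
    (LinearMap.lTensor W (LinearMap.mulRight k a)))
  map_one' := by
    apply unop_injective
    ext <;> simp
  map_mul' x y := by
    apply unop_injective
    ext <;> simp
  map_zero' := by
    apply unop_injective
    ext <;> simp
  map_add' x y := by
    apply unop_injective
    ext <;> simp [mul_add, tmul_add]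
  commutes' c := by
    apply unop_injective
    have h (m : M) : op (algebraMap k (A i) c) • m = c • m := algebraMap_smul (A i)ᵐᵒᵖ c m
    ext <;> simp [← Algebra.commutes, ← Algebra.smul_def, h]

variable {M W}

theorem baseAction_fst (a : ∀ l, A l) (n : M × (W ⊗[k] ∀ l, A l)) :
    ((baseAction A i M W a).unop n).1 = op (a i) • n.1 := rfl

theorem baseAction_tmul (a x : ∀ l, A l) (w : W) :
    (baseAction A i M W a).unop ((0 : M), w ⊗ₜ[k] x) = (0, w ⊗ₜ[k] (x * a)) := by
  ext
  · rw [baseAction_fst, smul_zero]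
  · rfl

end BaseAction

section Bound

variable {k : Type*} [Field k] {V : Type*} [Quiver V] {A : V → Type*}
  [∀ i, Ring (A i)] [∀ i, Algebra k (A i)]
  (P : ∀ i, BoundPresentation k (A i)) (I : Set (Relation k V))

/-! ### Generators of the cone -/

section Spanning

variable {κ : V → Type*} (b : ∀ l, Module.Basis (κ l) k (A l)) {i : V} {M : Type*}
  [AddCommGroup M] [Module k M] [Module (A i)ᵐᵒᵖ M] {τ : Type*} (μ : Module.Basis τ k M)

/-- The subspace of the cone spanned by the multiples of the classes of the formal sequences that
end at `l`. -/
noncomputable def wordSpan (l : V) : Submodule k (Cone P I i M) :=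
  Submodule.span k {x | ∃ (p : τ) (s : Word κ i l) (c : κ l),
    x = op (BoundGPA.elem P I l (b l c)) • Cone.tmul P I i (μ p) (s.elem P I b)}

variable {P I}

/-- The product is linear in the last coefficient, so basis elements suffice. -/
theorem elem_smul_mem_wordSpan {l : V} (p : τ) (s : Word κ i l) (a : A l) :
    op (BoundGPA.elem P I l a) • Cone.tmul P I i (μ p) (s.elem P I b) ∈ wordSpan P I b μ l := by
  let f : A l →ₗ[k] Cone P I i M :=
    Cone.tmulHom P I i M (μ p) ∘ₗ LinearMap.mulLeft k (s.elem P I b) ∘ₗ BoundGPA.elemLinear P I l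
  have hf : ∀ a, f a = op (BoundGPA.elem P I l a) • Cone.tmul P I i (μ p) (s.elem P I b) :=
    fun a => rfl
  rw [← hf, ← Submodule.mem_comap]
  have h : (⊤ : Submodule k (A l)) ≤ (wordSpan P I b μ l).comap f := by
    rw [← (b l).span_eq, Submodule.span_le]
    rintro _ ⟨c, rfl⟩
    exact Submodule.subset_span ⟨p, s, c, hf _⟩
  exact h trivial

theorem tmul_mem_wordSpan {l : V} (p : τ) (s : Word κ i l) :
    Cone.tmul P I i (μ p) (s.elem P I b) ∈ wordSpan P I b μ l := by
  have h := elem_smul_mem_wordSpan (P := P) (I := I) b μ p s 1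
  rwa [Cone.op_smul_tmul, Word.elem_mul_one] at h

theorem base_smul_mem_wordSpan {l : V} (a : ∀ l, A l) {x : Cone P I i M}
    (hx : x ∈ wordSpan P I b μ l) : op (BoundGPA.base P I a) • x ∈ wordSpan P I b μ l := by
  induction hx using Submodule.span_induction with
  | mem x hx =>
    obtain ⟨p, s, c, rfl⟩ := hx
    rw [← mul_smul, ← op_mul, BoundGPA.elem_mul_base]
    exact elem_smul_mem_wordSpan b μ p s _
  | zero => rw [smul_zero]; exact Submodule.zero_mem _
  | add y z _ _ hy hz => rw [smul_add]; exact Submodule.add_mem _ hy hz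
  | smul c y _ hy =>
    rw [smul_algebra_smul_comm]
    exact Submodule.smul_mem _ c hy

/-- Appending a basis element and an arrow to a formal sequence gives a formal sequence, and an
arrow that starts at another vertex gives zero. -/
theorem arrow_smul_mem_wordSpan {l j j' : V} (α : j ⟶ j') {x : Cone P I i M}
    (hx : x ∈ wordSpan P I b μ l) : op (BoundGPA.arrow P I α) • x ∈ wordSpan P I b μ j' := by
  induction hx using Submodule.span_induction with
  | mem x hx =>
    obtain ⟨p, s, c, rfl⟩ := hx
    rw [← mul_smul, ← op_mul]
    by_cases h : l = j
    · subst h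
      rw [Cone.op_smul_tmul, ← mul_assoc]
      exact tmul_mem_wordSpan b μ p (s.snoc c α)
    · rw [BoundGPA.elem_mul_arrow_of_ne P I h, op_zero, zero_smul]
      exact Submodule.zero_mem _
  | zero => rw [smul_zero]; exact Submodule.zero_mem _
  | add y z _ _ hy hz => rw [smul_add]; exact Submodule.add_mem _ hy hz
  | smul c y _ hy =>
    rw [smul_algebra_smul_comm]
    exact Submodule.smul_mem _ c hy

theorem Cone.base_smul_tmul_one (m : M) (a : ∀ l, A l) :
    op (BoundGPA.base P I a) • Cone.tmul P I i m 1 = Cone.tmul P I i (op (a i) • m) 1 := by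
  rw [Cone.op_smul_tmul, one_mul, ← Cone.tmul_base_mul, mul_one]

theorem Cone.tmul_arrow_of_ne {j j' : V} (h : i ≠ j) (m : M) (α : j ⟶ j') :
    Cone.tmul P I i m (BoundGPA.arrow P I α) = 0 := by
  rw [← BoundGPA.elem_one_mul_arrow, BoundGPA.elem, Cone.tmul_base_mul, inc_ne h, op_zero,
    zero_smul, ← Cone.tmulHom_apply, map_zero, LinearMap.zero_apply]

theorem tmul_arrow_mem_wordSpan {j j' : V} (α : j ⟶ j') (m : M) :
    Cone.tmul P I i m (BoundGPA.arrow P I α) ∈ wordSpan P I b μ j' := by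
  by_cases h : i = j
  · subst h
    let f : M →ₗ[k] Cone P I i M := (Cone.tmulHom P I i M).flip (BoundGPA.arrow P I α)
    change f m ∈ _
    rw [← Submodule.mem_comap]
    have h : (⊤ : Submodule k M) ≤ (wordSpan P I b μ j').comap f := by
      rw [← μ.span_eq, Submodule.span_le]
      rintro _ ⟨p, rfl⟩
      exact tmul_mem_wordSpan b μ p (.single α)
    exact h trivial
  · rw [Cone.tmul_arrow_of_ne h]
    exact Submodule.zero_mem _

variable (P I)

/-- The cone is the sum of the image of `M` and of the spans of the classes. -/
theorem range_sup_iSup_wordSpan :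
    LinearMap.range ((Cone.tmulHom P I i M).flip 1) ⊔ ⨆ l, wordSpan P I b μ l = ⊤ := by
  set T := LinearMap.range ((Cone.tmulHom P I i M).flip 1) ⊔ ⨆ l, wordSpan P I b μ l with hT
  have hM : ∀ m, Cone.tmul P I i m 1 ∈ T := fun m => Submodule.mem_sup_left ⟨m, rfl⟩
  have hW : ∀ l, wordSpan P I b μ l ≤ T := fun l => (le_iSup _ l).trans le_sup_right
  have red : ∀ r : BoundGPA P I, (∀ m, op r • Cone.tmul P I i m 1 ∈ T) →
      (∀ l, ∀ x ∈ wordSpan P I b μ l, op r • x ∈ T) → ∀ x ∈ T, op r • x ∈ T := by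
    intro r h1 h2
    change T ≤ T.comap (Algebra.lsmul k k (Cone P I i M) (op r))
    refine sup_le ?_ (iSup_le fun l x hx => h2 l x hx)
    rintro _ ⟨m, rfl⟩
    exact h1 m
  -- `T` is stable under `Λ`, and the elements `m ⊗ 1` generate the cone.
  have key : ∀ z : GPA k A, ∀ x ∈ T, op (BoundGPA.mk P I z) • x ∈ T := by
    intro z
    induction z using GPA.induction with
    | base a =>
      refine red _ (fun m => ?_) fun l x hx => hW l (base_smul_mem_wordSpan b μ a hx)
      have h := Cone.base_smul_tmul_one (P := P) (I := I) (i := i) m a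
      exact h ▸ hM _
    | arrow α =>
      refine red _ (fun m => ?_) fun l x hx => hW _ (arrow_smul_mem_wordSpan b μ α hx)
      rw [Cone.op_smul_tmul, one_mul]
      exact hW _ (tmul_arrow_mem_wordSpan b μ α m)
    | mul x y hx hy =>
      intro t ht
      rw [map_mul, op_mul, mul_smul]
      exact hy _ (hx _ ht)
    | add x y hx hy =>
      intro t ht
      rw [map_add, op_add, add_smul]
      exact T.add_mem (hx _ ht) (hy _ ht)
  rw [eq_top_iff, ← Cone.span_tmul P I i (M := M), Submodule.span_le]
  rintro _ ⟨m, l, rfl⟩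
  obtain ⟨z, rfl⟩ := BoundGPA.mk_surjective P I l
  have h := key z _ (hM m)
  rwa [Cone.op_smul_tmul, one_mul] at h

/-- The component at `j` of the cone is spanned by the component at `j` of the image of `M` and by
the multiples of the classes of the formal sequences that end at `j`. -/
theorem elem_one_smul_mem (j : V) (x : Cone P I i M) :
    op (BoundGPA.elem P I j 1) • x ∈
      LinearMap.range ((Cone.tmulHom P I i M).flip (BoundGPA.elem P I j 1)) ⊔
        wordSpan P I b μ j := by
  set T := LinearMap.range ((Cone.tmulHom P I i M).flip (BoundGPA.elem P I j 1)) ⊔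
    wordSpan P I b μ j
  have h : (⊤ : Submodule k (Cone P I i M)) ≤
      T.comap (Algebra.lsmul k k (Cone P I i M) (op (BoundGPA.elem P I j 1))) := by
    rw [← range_sup_iSup_wordSpan P I b μ]
    refine sup_le ?_ (iSup_le fun l => ?_)
    · rintro _ ⟨m, rfl⟩
      refine Submodule.mem_sup_left ⟨m, ?_⟩
      change _ = op (BoundGPA.elem P I j 1) • Cone.tmul P I i m 1
      rw [Cone.op_smul_tmul, one_mul]
      rfl
    · by_cases h : l = j
      · subst h
        exact fun x hx => Submodule.mem_sup_right (base_smul_mem_wordSpan b μ _ hx)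
      · refine Submodule.span_le.2 ?_
        rintro _ ⟨p, s, c, rfl⟩
        change op (BoundGPA.elem P I j 1) • op (BoundGPA.elem P I l (b l c)) • _ ∈ T
        rw [← mul_smul, ← op_mul, BoundGPA.elem, BoundGPA.elem, ← map_mul, inc_mul_inc_of_ne h,
          map_zero, op_zero, zero_smul]
        exact T.zero_mem
  exact h trivial

/-- The idempotent `1_j` acts on `M` as zero for `j ≠ i`, so the image of `M` contributes nothing at
`j`. -/
theorem vertexModule_mem_span {j : V} (h : j ≠ i)
    (y : VertexModule P I (Cone P I i M) j) :
    y ∈ Submodule.span k {x | ∃ (p : τ) (s : Word κ i j) (c : κ j),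
      x = op (b j c) • seqClass P I b μ (p, s)} := by
  have hy := elem_one_smul_mem P I b μ j (VertexModule.val P I j y)
  have hr : LinearMap.range ((Cone.tmulHom P I i M).flip (BoundGPA.elem P I j 1)) = ⊥ := by
    rw [LinearMap.range_eq_bot]
    ext m
    change Cone.tmul P I i m (BoundGPA.elem P I j 1) = 0
    rw [← mul_one (BoundGPA.elem P I j 1), BoundGPA.elem, Cone.tmul_base_mul, inc_ne h.symm,
      op_zero, zero_smul, ← Cone.tmulHom_apply, map_zero, LinearMap.zero_apply]
  rw [hr, bot_sup_eq, VertexModule.val_mem] at hy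
  have hs : wordSpan P I b μ j = Submodule.map (VertexModule.val P I j)
      (Submodule.span k {x | ∃ (p : τ) (s : Word κ i j) (c : κ j),
        x = op (b j c) • seqClass P I b μ (p, s)}) := by
    rw [Submodule.map_span, wordSpan]
    congr 1
    ext x
    constructor
    · rintro ⟨p, s, c, rfl⟩
      exact ⟨_, ⟨p, s, c, rfl⟩, rfl⟩
    · rintro ⟨_, ⟨p, s, c, rfl⟩, rfl⟩
      exact ⟨p, s, c, rfl⟩
  rw [hs] at hy
  obtain ⟨z, hz, hzy⟩ := hy
  rwa [← VertexModule.val_injective P I j hzy]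

/-- A formal sequence has at least one arrow, so its path from `i` to `i` would be an oriented
cycle. -/
theorem Word.isEmpty_of_isAcyclicQuiver (hV : IsAcyclicQuiver V) : IsEmpty (Word κ i i) := by
  refine ⟨fun s => ?_⟩
  have h := hV i s.path
  cases s <;> simp [Word.path] at h

theorem vertexModule_eq_tmul (hV : IsAcyclicQuiver V) (y : VertexModule P I (Cone P I i M) i) :
    ∃ m, VertexModule.val P I i y = Cone.tmul P I i m 1 := by
  let b : ∀ l, Module.Basis _ k (A l) := fun l => Module.Basis.ofVectorSpace k (A l)
  let μ := Module.Basis.ofVectorSpace k M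
  have := Word.isEmpty_of_isAcyclicQuiver (κ := fun l => Module.Basis.ofVectorSpaceIndex k (A l))
    (i := i) hV
  have hy := elem_one_smul_mem P I b μ i (VertexModule.val P I i y)
  have hs : wordSpan P I (i := i) b μ i = ⊥ := by
    rw [wordSpan, Submodule.span_eq_bot]
    rintro _ ⟨p, s, c, rfl⟩
    exact isEmptyElim s
  rw [hs, sup_bot_eq, VertexModule.val_mem] at hy
  obtain ⟨m, hm⟩ := hy
  refine ⟨m, hm.symm.trans ?_⟩
  change Cone.tmul P I i m (BoundGPA.elem P I i 1) = _
  rw [← mul_one (BoundGPA.elem P I i 1), BoundGPA.elem, Cone.tmul_base_mul, inc_same, op_one,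
    one_smul]

end Spanning

/-! ### Mapping the cone to a model module -/

section Model

variable (i : V) (M : Type*) [AddCommGroup M] [Module k M] [Module (A i)ᵐᵒᵖ M]
  [IsScalarTower k (A i)ᵐᵒᵖ M] (W : Type*) [AddCommGroup W] [Module k W]

variable {M W}

/-- If linear maps `g_α : M × (W ⊗ ∏ A_l) → W` are such that the arrows act on `M × (W ⊗ ∏ A_l)`
through `n ↦ (0, g_α(n) ⊗ 1)` and the relations act trivially, then the cone maps to this module. -/
theorem Cone.exists_map_model
    (g : ∀ {j j' : V}, (j ⟶ j') → ((M × (W ⊗[k] ∀ l, A l)) →ₗ[k] W))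
    (hg : ∀ {j j' : V} (α : j ⟶ j') n, g α ((baseAction A i M W (inc j 1)).unop n) = g α n)
    (hI : ∀ Ψ : GPA k A →ₐ[k] (Module.End k (M × (W ⊗[k] ∀ l, A l)))ᵐᵒᵖ,
      (∀ a, Ψ (GPA.base k A a) = baseAction A i M W a) →
      (∀ {j j' : V} (α : j ⟶ j') n,
        (Ψ (GPA.arrow k A α)).unop n = (0, g α n ⊗ₜ[k] inc j' 1)) →
      ∀ z ∈ boundSet P I, Ψ z = 0) :
    ∃ θ : Cone P I i M →ₗ[k] M × (W ⊗[k] ∀ l, A l),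
      (∀ m, θ (Cone.tmul P I i m 1) = (m, 0)) ∧
      (∀ a x, θ (op (BoundGPA.base P I a) • x) = (baseAction A i M W a).unop (θ x)) ∧
      ∀ {j j' : V} (α : j ⟶ j') x,
        θ (op (BoundGPA.arrow P I α) • x) = (0, g α (θ x) ⊗ₜ[k] inc j' 1) := by
  obtain ⟨Ψ, hΨb, hΨa⟩ := GPA.exists_lift (baseAction A i M W)
    (fun {j j'} α => op (LinearMap.inr k M (W ⊗[k] ∀ l, A l) ∘ₗ
      (TensorProduct.mk k W (∀ l, A l)).flip (inc j' 1) ∘ₗ g α)) (by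
    intro j j' α
    apply unop_injective
    refine LinearMap.ext fun n => ?_
    change (baseAction A i M W (inc j' 1)).unop
      (0, g α ((baseAction A i M W (inc j 1)).unop n) ⊗ₜ[k] inc j' 1) =
        (0, g α n ⊗ₜ[k] inc j' 1)
    rw [baseAction_tmul, hg, ← inc_mul, one_mul])
  have hΨa' : ∀ {j j' : V} (α : j ⟶ j') n,
      (Ψ (GPA.arrow k A α)).unop n = (0, g α n ⊗ₜ[k] inc j' 1) := by
    intro j j' α n
    rw [hΨa]
    rfl
  obtain ⟨Φ, hΦ⟩ := BoundGPA.exists_lift P I Ψ (hI Ψ hΨb hΨa')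
  have hbase : ∀ a, Φ (BoundGPA.base P I a) = baseAction A i M W a := fun a =>
    (hΦ _).trans (hΨb a)
  obtain ⟨θ, hθ⟩ := Cone.exists_lift P I i Φ (LinearMap.inl k M (W ⊗[k] ∀ l, A l)) (by
    intro m a
    rw [hbase]
    ext
    · rfl
    · exact map_zero (LinearMap.lTensor W (LinearMap.mulRight k a)))
  have hsmul : ∀ (r : BoundGPA P I) x, θ (op r • x) = (Φ r).unop (θ x) := by
    intro r x
    have h : (⊤ : Submodule k (Cone P I i M)) ≤
        LinearMap.eqLocus (θ ∘ₗ (Algebra.lsmul k k (Cone P I i M) (op r) : _ →ₗ[k] _))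
          ((Φ r).unop ∘ₗ θ) := by
      rw [← Cone.span_tmul, Submodule.span_le]
      rintro _ ⟨m, l, rfl⟩
      change θ (op r • Cone.tmul P I i m l) = (Φ r).unop (θ (Cone.tmul P I i m l))
      rw [Cone.op_smul_tmul, hθ, hθ, map_mul, unop_mul]
      rfl
    exact h trivial
  refine ⟨θ, fun m => ?_, fun a x => ?_, fun α x => ?_⟩
  · rw [hθ, map_one]
    rfl
  · rw [hsmul, hbase]
  · rw [hsmul, BoundGPA.arrow, hΦ, hΨa']

end Model

end Bound

/-! ### Independence over `A_j` from pure tensors -/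

section PureTensors

variable {k : Type*} [Field k] {V : Type*} {A : V → Type*}
  [∀ i, Ring (A i)] [∀ i, Algebra k (A i)]

/-- A family in a right `A_j`-module is independent if a linear map takes its multiples to pure
tensors `w_s ⊗ a` with linearly independent `w_s`. -/
theorem linearIndependent_of_tmul {j : V} {N ι W : Type*} [AddCommGroup N] [Module k N]
    [Module (A j)ᵐᵒᵖ N] [AddCommGroup W] [Module k W] (v : ι → N) (w : ι → W)
    (hw : LinearIndependent k w) (θ : N →ₗ[k] W ⊗[k] ∀ l, A l)
    (h : ∀ s (a : A j), θ (op a • v s) = w s ⊗ₜ[k] inc j a) : LinearIndependent (A j)ᵐᵒᵖ v := by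
  rw [linearIndependent_iff]
  intro l hl
  -- `r` reads off coordinates with respect to the independent family `w`.
  obtain ⟨r, hr⟩ := LinearMap.exists_leftInverse_of_injective (Finsupp.linearCombination k w)
    (LinearMap.ker_eq_bot.2 hw)
  have hrw : ∀ s, r (w s) = Finsupp.single s 1 := by
    intro s
    have := LinearMap.congr_fun hr (Finsupp.single s 1)
    simpa using this
  ext s
  -- The coordinate of index `s`: it sends `v_t a` to `a` if `t = s` and to `0` otherwise. Being
  -- `k`-linear is enough, since the coefficient `a` survives in the second tensor factor.
  let f : N →ₗ[k] A j := LinearMap.proj j ∘ₗ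
    (TensorProduct.lid k (∀ l, A l)).toLinearMap ∘ₗ
      LinearMap.rTensor _ (Finsupp.lapply s ∘ₗ r) ∘ₗ θ
  have hf : ∀ t (a : A j), f (op a • v t) = (Finsupp.single t (1 : k) s) • a := by
    intro t a
    simp [f, h, hrw, inc_same]
  have h0 := congrArg f hl
  rw [Finsupp.linearCombination_apply, Finsupp.sum, map_sum, map_zero] at h0
  by_cases hs : s ∈ l.support
  · rw [Finset.sum_eq_single s] at h0
    · rw [← op_unop (l s), hf, Finsupp.single_eq_same, one_smul] at h0
      rw [Finsupp.zero_apply, ← op_unop (l s), h0, op_zero]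
    · intro t _ ht
      rw [← op_unop (l t), hf, Finsupp.single_eq_of_ne ht.symm, zero_smul]
    · exact fun h => (h hs).elim
  · simpa using hs

end PureTensors

section Bound

variable {k : Type*} [Field k] {V : Type*} [Quiver V] {A : V → Type*}
  [∀ i, Ring (A i)] [∀ i, Algebra k (A i)]
  (P : ∀ i, BoundPresentation k (A i)) (I : Set (Relation k V))

/-! ### The cone as its own model -/

section Independence

variable (i : V) (M : Type*) [AddCommGroup M] [Module k M] [Module (A i)ᵐᵒᵖ M]

/-- The map `M × (𝒞 ⊗ ∏ A_l) → 𝒞`, `(m, x ⊗ a) ↦ m ⊗ 1 + x a`, to the cone `𝒞`. -/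
noncomputable def coneAction :
    (M × (Cone P I i M ⊗[k] ∀ l, A l)) →ₗ[k] Cone P I i M :=
  LinearMap.coprod ((Cone.tmulHom P I i M).flip 1)
    (TensorProduct.lift
      (LinearMap.mk₂ k (fun x a => op (BoundGPA.base P I a) • x)
        (fun x y a => smul_add _ x y) (fun c x a => smul_algebra_smul_comm _ _ _)
        (fun x a a' => by rw [map_add, op_add, add_smul])
        (fun c x a => by rw [map_smul, op_smul, smul_assoc])))

variable {M}

theorem coneAction_apply_zero (m : M) : coneAction P I i M (m, 0) = Cone.tmul P I i m 1 := by
  rw [coneAction, LinearMap.coprod_apply, map_zero, add_zero]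
  rfl

theorem coneAction_tmul (x : Cone P I i M) (a : ∀ l, A l) :
    coneAction P I i M (0, x ⊗ₜ[k] a) = op (BoundGPA.base P I a) • x := by
  rw [coneAction, LinearMap.coprod_apply, map_zero, zero_add]
  rfl

variable [IsScalarTower k (A i)ᵐᵒᵖ M]

/-- Evaluation respects the base algebra because `(x a) a' = x (a a')` and, on `M`, because `(m ⊗ 1)
a = m a_i ⊗ 1`. -/
theorem coneAction_baseAction (a : ∀ l, A l) (n : M × (Cone P I i M ⊗[k] ∀ l, A l)) :
    coneAction P I i M ((baseAction A i M (Cone P I i M) a).unop n) =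
      op (BoundGPA.base P I a) • coneAction P I i M n := by
  suffices h : coneAction P I i M ∘ₗ (baseAction A i M (Cone P I i M) a).unop =
      (Algebra.lsmul k k (Cone P I i M) (op (BoundGPA.base P I a)) :
        Cone P I i M →ₗ[k] Cone P I i M) ∘ₗ
        coneAction P I i M from LinearMap.congr_fun h n
  refine LinearMap.prod_ext (LinearMap.ext fun m => ?_) (TensorProduct.ext' fun x y => ?_)
  · have h1 : (baseAction (k := k) A i M (Cone P I i M) a).unop (m, 0) = (op (a i) • m, 0) := by
      ext
      · rfl
      · exact map_zero (LinearMap.lTensor (Cone P I i M) (LinearMap.mulRight k a))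
    change coneAction P I i M ((baseAction A i M (Cone P I i M) a).unop (m, 0)) =
      op (BoundGPA.base P I a) • coneAction P I i M (m, 0)
    rw [h1, coneAction_apply_zero, coneAction_apply_zero, Cone.base_smul_tmul_one]
  · change coneAction P I i M ((baseAction A i M (Cone P I i M) a).unop (0, x ⊗ₜ y)) =
      op (BoundGPA.base P I a) • coneAction P I i M (0, x ⊗ₜ y)
    rw [baseAction_tmul, coneAction_tmul, coneAction_tmul, map_mul, op_mul, mul_smul]

/-- The cone `𝒞` embeds in `M × (𝒞 ⊗ ∏ A_l)` such that `m ⊗ 1` goes to `(m, 0)` and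
`x α a` to `(0, x α ⊗ a)`. -/
theorem Cone.exists_embedding :
    ∃ θ : Cone P I i M →ₗ[k] M × (Cone P I i M ⊗[k] ∀ l, A l),
      (∀ m, θ (Cone.tmul P I i m 1) = (m, 0)) ∧
      ∀ {j j' : V} (α : j ⟶ j') (a : A j') x,
        θ (op (BoundGPA.elem P I j' a) • op (BoundGPA.arrow P I α) • x) =
          (0, (op (BoundGPA.arrow P I α) • x) ⊗ₜ[k] inc j' a) := by
  -- An arrow evaluates the vector in the cone and multiplies the value by `α`; the model stores
  -- this in the left tensor factor and restarts the coefficient at `1`.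
  let g : ∀ {j j' : V}, (j ⟶ j') → ((M × (Cone P I i M ⊗[k] ∀ l, A l)) →ₗ[k] Cone P I i M) :=
    fun α => (Algebra.lsmul k k (Cone P I i M) (op (BoundGPA.arrow P I α)) : _ →ₗ[k] _) ∘ₗ
      coneAction P I i M
  have hg : ∀ {j j' : V} (α : j ⟶ j') n,
      g α n = op (BoundGPA.arrow P I α) • coneAction P I i M n := fun _ _ => rfl
  obtain ⟨θ, h1, h2, h3⟩ := Cone.exists_map_model P I i g (fun α n => by
    rw [hg, hg, coneAction_baseAction, ← mul_smul, ← op_mul]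
    congr 3
    exact BoundGPA.elem_one_mul_arrow P I α) (by
    intro Ψ hb ha
    -- Evaluation intertwines the action on the model with the action on the cone.
    have hmk : ∀ z n, coneAction P I i M ((Ψ z).unop n) =
        op (BoundGPA.mk P I z) • coneAction P I i M n := by
      intro z
      induction z using GPA.induction with
      | base a =>
        intro n
        rw [hb, coneAction_baseAction]
        rfl
      | arrow α =>
        intro n
        rw [ha, coneAction_tmul, hg, ← mul_smul, ← op_mul]
        congr 2
        exact BoundGPA.arrow_mul_elem P I α
      | mul x y hx hy =>
        intro n
        rw [map_mul, unop_mul, map_mul, op_mul, mul_smul, ← hx, ← hy]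
        rfl
      | add x y hx hy =>
        intro n
        rw [map_add, unop_add, LinearMap.add_apply, map_add, hx, hy, map_add, op_add, add_smul]
    -- Only the last arrow matters: `hmk` evaluates everything before it in the cone, so a case
    -- distinction suffices in place of an induction.
    have hint : ∀ {j l : V} (p : Quiver.Path j l) (z : GPA k A), IsInterleaving P p z →
        ∀ n, (Ψ z).unop n =
          (0, (op (BoundGPA.mk P I z) • coneAction P I i M n) ⊗ₜ[k] inc l 1) := by
      intro j l p z hz n
      cases hz with
      | single β => exact ha β n
      | cons p z β γ h =>
        rw [map_mul Ψ, unop_mul, Module.End.mul_apply, ha, hg, hmk, ← mul_smul, ← op_mul,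
          map_mul (BoundGPA.mk P I) _ (GPA.arrow k A β)]
        rfl
    intro z hz
    have h0 := BoundGPA.mk_eq_zero P I hz
    obtain ⟨ρ, hρ, f, hf, rfl⟩ := hz
    apply unop_injective
    refine LinearMap.ext fun n => ?_
    classical
    -- The paths of a relation end at the same vertex, so their terms share the factor `inc ρ.tgt 1`
    -- and add up in the cone: the relation acts through its class in `Λ`. The sums stay inside the
    -- support because `f p` is known to be an interleaving only there.
    have h : ∀ T : Finset (Quiver.Path ρ.src ρ.tgt), T ⊆ ρ.coeff.support →
        (Ψ (∑ p ∈ T, ρ.coeff p • f p)).unop n =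
          (0, (op (BoundGPA.mk P I (∑ p ∈ T, ρ.coeff p • f p)) • coneAction P I i M n)
            ⊗ₜ[k] inc ρ.tgt 1) := by
      intro T
      induction T using Finset.induction_on with
      | empty => intro _; simp [Prod.mk_zero_zero]
      | insert p T hp ih =>
        intro hT
        rw [Finset.sum_insert hp, map_add, map_smul, unop_add, unop_smul, LinearMap.add_apply,
          LinearMap.smul_apply, ih ((Finset.subset_insert p T).trans hT),
          hint p _ (hf p (hT (Finset.mem_insert_self p T))), map_add, map_smul, op_add, add_smul,
          op_smul, smul_assoc, add_tmul, Prod.smul_mk, smul_tmul', Prod.mk_add_mk, smul_zero,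
          add_zero]
    refine (h _ subset_rfl).trans ?_
    rw [Finsupp.sum] at h0
    rw [h0, op_zero, zero_smul, zero_tmul]
    rfl)
  -- Evaluation is a left inverse of `θ`; this turns `g α (θ x)` into `x α`.
  have h4 : ∀ x, coneAction P I i M (θ x) = x := by
    have hmk : ∀ z x, coneAction P I i M (θ x) = x →
        coneAction P I i M (θ (op (BoundGPA.mk P I z) • x)) = op (BoundGPA.mk P I z) • x := by
      intro z
      induction z using GPA.induction with
      | base a =>
        intro x hx
        change coneAction P I i M (θ (op (BoundGPA.base P I a) • x)) = _
        rw [h2, coneAction_baseAction, hx]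
        rfl
      | arrow α =>
        intro x hx
        change coneAction P I i M (θ (op (BoundGPA.arrow P I α) • x)) = _
        rw [h3, coneAction_tmul, hg, hx, ← mul_smul, ← op_mul]
        congr 2
        exact BoundGPA.arrow_mul_elem P I α
      | mul y z hy hz =>
        intro x hx
        rw [map_mul, op_mul, mul_smul]
        exact hz _ (hy _ hx)
      | add y z hy hz =>
        intro x hx
        rw [map_add, op_add, add_smul, map_add, map_add, hy _ hx, hz _ hx]
    intro x
    have h : (⊤ : Submodule k (Cone P I i M)) ≤
        LinearMap.eqLocus (coneAction P I i M ∘ₗ θ) LinearMap.id := by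
      rw [← Cone.span_tmul P I i (M := M), Submodule.span_le]
      rintro _ ⟨m, l, rfl⟩
      obtain ⟨z, rfl⟩ := BoundGPA.mk_surjective P I l
      have := hmk z (Cone.tmul P I i m 1) (by rw [h1, coneAction_apply_zero])
      rwa [Cone.op_smul_tmul, one_mul] at this
    exact h trivial
  refine ⟨θ, h1, fun {j j'} α a x => ?_⟩
  rw [BoundGPA.elem, h2, h3, baseAction_tmul, hg, h4, inc_mul_pi, inc_same, one_mul]

end Independence

/-! ### Vanishing of formal sequences under monomial relations -/

section Monomial

variable {P I}

/-- A formal sequence whose path ends with `q` is a combination of multiples of the interleavings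
of `q`. -/
theorem Word.elem_mem_span_interleaving {κ : V → Type*} (b : ∀ l, Module.Basis (κ l) k (A l))
    {i j : V} (s : Word κ i j) : ∀ {l : V} (q : Quiver.Path l j) (y : Quiver.Path i l),
    1 ≤ q.length → s.path = y.comp q →
      s.elem P I b ∈ Submodule.span k {x : BoundGPA P I | ∃ (u : BoundGPA P I) (z : GPA k A),
        IsInterleaving P q z ∧ x = u * BoundGPA.mk P I z} := by
  induction s with
  | single α =>
    intro l q y hq h
    cases q with
    | nil => simp at hq
    | cons q β =>
      rw [Word.path, Quiver.Path.comp_cons] at h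
      obtain rfl := Quiver.Path.obj_eq_of_cons_eq_cons h
      obtain rfl := eq_of_heq (Quiver.Path.hom_heq_of_cons_eq_cons h)
      have h' := eq_of_heq (Quiver.Path.heq_of_cons_eq_cons h)
      have hl := congrArg Quiver.Path.length h'
      rw [Quiver.Path.length_nil, Quiver.Path.length_comp] at hl
      cases q with
      | nil => exact Submodule.subset_span ⟨1, _, .single _, (one_mul _).symm⟩
      | cons q β => simp at hl
  | @snoc j₁ j₂ s c α ih =>
    intro l q y hq h
    cases q with
    | nil => simp at hq
    | cons q β =>
      rw [Word.path, Quiver.Path.comp_cons] at h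
      obtain rfl := Quiver.Path.obj_eq_of_cons_eq_cons h
      obtain rfl := eq_of_heq (Quiver.Path.hom_heq_of_cons_eq_cons h)
      have h' := eq_of_heq (Quiver.Path.heq_of_cons_eq_cons h)
      cases q with
      | nil => exact Submodule.subset_span ⟨_, _, .single _, rfl⟩
      | cons q β =>
        have hs := ih (q.cons β) y (by simp) h'
        rw [Word.elem]
        set T := Submodule.span k {x : BoundGPA P I | ∃ (u : BoundGPA P I) (z : GPA k A),
          IsInterleaving P ((q.cons β).cons α) z ∧ x = u * BoundGPA.mk P I z}
        generalize s.elem P I b = e at hs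
        induction hs using Submodule.span_induction with
        | mem x hx =>
          obtain ⟨u, z, hz, rfl⟩ := hx
          let f : A j₁ →ₗ[k] BoundGPA P I :=
            LinearMap.mulRight k (BoundGPA.arrow P I α) ∘ₗ
              LinearMap.mulLeft k (u * BoundGPA.mk P I z) ∘ₗ BoundGPA.elemLinear P I j₁
          -- Interleavings use only classes of paths of the quiver at `j₁`. These span `A j₁` and
          -- `f` is linear, so the basis element `b j₁ c` may be inserted as well.
          have hf : ⊤ ≤ T.comap f := by
            rw [← (P j₁).span_proj, Submodule.span_le]
            rintro _ ⟨a, b', γ, rfl⟩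
            refine Submodule.subset_span ⟨u, _, .cons _ z α γ hz, ?_⟩
            rw [map_mul, map_mul, ← mul_assoc, ← mul_assoc]
            rfl
          exact hf (x := b j₁ c) trivial
        | zero => rw [zero_mul, zero_mul]; exact T.zero_mem
        | add x y _ _ hx hy => rw [add_mul, add_mul]; exact T.add_mem hx hy
        | smul t x _ hx => rw [smul_mul_assoc, smul_mul_assoc]; exact T.smul_mem t hx

/-- For monomial relations, a formal sequence that contains a path of a relation is zero. -/
theorem Word.elem_eq_zero (hI : IsMonomial I) {κ : V → Type*}
    (b : ∀ l, Module.Basis (κ l) k (A l)) {i j : V} (s : Word κ i j)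
    (hs : ContainsRelationPath I s.path) : s.elem P I b = 0 := by
  obtain ⟨ρ, hρ, q, hq, y, z, h⟩ := hs
  have hlen := ρ.two_le q hq
  have hz : ∀ x, IsInterleaving P q x → BoundGPA.mk P I x = 0 := by
    intro x hx
    obtain ⟨q', c, hc, hqc⟩ := hI ρ hρ
    have hmem : c • x ∈ boundSet P I := by
      -- The support of the relation is the single path `q`, so a constant choice of interleaving is
      -- legitimate.
      refine ⟨ρ, hρ, fun _ => x, fun p hp => ?_, ?_⟩
      · rw [hqc, Finsupp.mem_support_single] at hp hq
        rwa [hp.1, ← hq.1]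
      · rw [hqc, Finsupp.sum_single_index (zero_smul k x)]
    have h := BoundGPA.mk_eq_zero P I hmem
    rw [map_smul] at h
    exact (smul_eq_zero.1 h).resolve_left hc
  induction s with
  | single α =>
    have := congrArg Quiver.Path.length h
    simp [Word.path] at this
    omega
  | snoc s c α ih =>
    -- Either the path of the relation is a suffix, or it already occurs in the shorter sequence.
    cases z with
    | nil =>
      have hspan := Word.elem_mem_span_interleaving (P := P) (I := I) b (s.snoc c α) q y
        (by omega) h
      rw [Submodule.span_eq_bot.2] at hspan
      · exact hspan
      · rintro _ ⟨u, x, hx, rfl⟩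
        rw [hz x hx, mul_zero]
    | cons z β =>
      rw [Word.path, Quiver.Path.comp_cons] at h
      obtain rfl := Quiver.Path.obj_eq_of_cons_eq_cons h
      rw [Word.elem, ih z (eq_of_heq (Quiver.Path.heq_of_cons_eq_cons h)), zero_mul, zero_mul]

theorem ContainsRelationPath.cons {i j l : V} {p : Quiver.Path i j}
    (h : ContainsRelationPath I p) (α : j ⟶ l) : ContainsRelationPath I (p.cons α) := by
  obtain ⟨ρ, hρ, q, hq, y, z, rfl⟩ := h
  exact ⟨ρ, hρ, q, hq, y, z.cons α, rfl⟩

end Monomial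

end Bound

section Bound

variable {k : Type*} [Field k] {V : Type*} [Quiver V] {A : V → Type*}
  [∀ i, Ring (A i)] [∀ i, Algebra k (A i)]
  (P : ∀ i, BoundPresentation k (A i)) (I : Set (Relation k V))

/-! ### The model built from formal sequences -/

section WordModel

variable {κ : V → Type*} {i : V} {τ : Type*}

variable (k κ i τ) in
/-- The space of linear combinations of the formal sequences that start at `i`. -/
abbrev WordSpace : Type _ := (τ × Σ l, Word κ i l) →₀ k

/-- The basis vector of a formal sequence if this does not contain a path of a relation, and `0`
otherwise. -/
noncomputable def wordVec (p : τ) {l : V} (s : Word κ i l) : WordSpace k κ i τ :=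
  open scoped Classical in
  if ContainsRelationPath I s.path then 0 else Finsupp.single (p, ⟨l, s⟩) 1

theorem wordVec_of_contains (p : τ) {l : V} {s : Word κ i l} (h : ContainsRelationPath I s.path) :
    wordVec I p s = 0 := if_pos h

theorem wordVec_of_not_contains (p : τ) {l : V} {s : Word κ i l}
    (h : ¬ ContainsRelationPath I s.path) :
    wordVec I p s = Finsupp.single (p, ⟨l, s⟩) 1 := if_neg h

variable (τ κ i) in
/-- The space spanned by the formal sequences whose paths end with `q` and do not contain a path of
a relation. -/
noncomputable def suffixSpan {j l : V} (q : Quiver.Path j l) :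
    Submodule k (WordSpace k κ i τ) :=
  Submodule.span k {w | ∃ (p : τ) (s : Word κ i l), ¬ ContainsRelationPath I s.path ∧
    (∃ y : Quiver.Path i j, s.path = y.comp q) ∧ w = Finsupp.single (p, ⟨l, s⟩) 1}

theorem wordVec_mem_suffixSpan (p : τ) {j l : V} {s : Word κ i l} {q : Quiver.Path j l}
    {y : Quiver.Path i j} (h : s.path = y.comp q) : wordVec I p s ∈ suffixSpan I κ i τ q := by
  by_cases hs : ContainsRelationPath I s.path
  · rw [wordVec_of_contains I p hs]
    exact Submodule.zero_mem _
  · rw [wordVec_of_not_contains I p hs]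
    exact Submodule.subset_span ⟨p, s, hs, ⟨y, h⟩, rfl⟩

/-- A sequence that ends with a path of a relation contains it, so no generator is left. Hence
whatever an interleaving of `q` produces is zero. -/
theorem suffixSpan_eq_bot {ρ : Relation k V} (hρ : ρ ∈ I) {q : Quiver.Path ρ.src ρ.tgt}
    (hq : q ∈ ρ.coeff.support) : suffixSpan I κ i τ q = ⊥ := by
  rw [suffixSpan, Submodule.span_eq_bot]
  rintro _ ⟨p, s, hs, ⟨y, hy⟩, rfl⟩
  exact (hs ⟨ρ, hρ, q, hq, y, .nil, hy⟩).elim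

theorem constr_mem {R ι N N' : Type*} [Field R] [AddCommGroup N] [Module R N] [AddCommGroup N']
    [Module R N'] (b : Module.Basis ι R N) {f : ι → N'} {D : Submodule R N'} (h : ∀ c, f c ∈ D)
    (x : N) : b.constr R f x ∈ D := by
  rw [Module.Basis.constr_apply]
  exact Submodule.sum_mem _ fun c _ => D.smul_mem _ (h c)

variable (b : ∀ l, Module.Basis (κ l) k (A l)) {M : Type*}
  [AddCommGroup M] [Module k M] (μ : Module.Basis τ k M)

variable (i) in
/-- The arrow `α` applied to a basis vector of `M`. -/
noncomputable def startVec {j j' : V} (α : j ⟶ j') (p : τ) : WordSpace k κ i τ :=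
  open scoped Classical in
  if h : j = i then wordVec I p (.single (h ▸ α)) else 0

/-- A basis element of `A_j` and then the arrow `α : j ⟶ j'` applied to a formal sequence. -/
noncomputable def snocVec {j j' : V} (α : j ⟶ j') (x : τ × Σ l, Word κ i l) (c : κ j) :
    WordSpace k κ i τ :=
  open scoped Classical in
  if h : x.2.1 = j then wordVec I x.1 ((h ▸ x.2.2 : Word κ i j).snoc c α) else 0

variable (i) in
/-- The action of an arrow on the module of formal sequences. -/
noncomputable def wordAction {j j' : V} (α : j ⟶ j') :
    (M × (WordSpace k κ i τ ⊗[k] ∀ l, A l)) →ₗ[k] WordSpace k κ i τ :=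
  LinearMap.coprod (μ.constr k (startVec I i α))
    (TensorProduct.lift (Finsupp.linearCombination k fun x =>
      (b j).constr k (snocVec I α x) ∘ₗ LinearMap.proj j))

theorem wordAction_inl {j j' : V} (α : j ⟶ j') (m : M) :
    wordAction I i b μ α (m, 0) = μ.constr k (startVec I i α) m := by
  rw [wordAction, LinearMap.coprod_apply, map_zero, add_zero]

theorem wordAction_inr {j j' : V} (α : j ⟶ j') (x : τ × Σ l, Word κ i l) (a : ∀ l, A l) :
    wordAction I i b μ α (0, Finsupp.single x 1 ⊗ₜ[k] a) =
      (b j).constr k (snocVec I α x) (a j) := by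
  rw [wordAction, LinearMap.coprod_apply, map_zero, zero_add, TensorProduct.lift.tmul,
    Finsupp.linearCombination_single, one_smul]
  rfl

theorem startVec_mem {j j' : V} (α : j ⟶ j') (p : τ) :
    startVec (κ := κ) (i := i) I α p ∈ suffixSpan I κ i τ (Quiver.Path.nil.cons α) := by
  rw [startVec]
  split_ifs with h
  · subst h
    exact wordVec_mem_suffixSpan I p (y := .nil) (by rfl)
  · exact Submodule.zero_mem _

theorem snocVec_mem {j j' : V} (α : j ⟶ j') (x : τ × Σ l, Word κ i l) (c : κ j) :
    snocVec I α x c ∈ suffixSpan I κ i τ (Quiver.Path.nil.cons α) := by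
  obtain ⟨p, l, s⟩ := x
  rw [snocVec]
  split_ifs with h
  · dsimp only at h
    subst h
    exact wordVec_mem_suffixSpan I p (y := s.path) (by rfl)
  · exact Submodule.zero_mem _

theorem wordAction_mem {j j' : V} (α : j ⟶ j')
    (n : M × (WordSpace k κ i τ ⊗[k] ∀ l, A l)) :
    wordAction I i b μ α n ∈ suffixSpan I κ i τ (Quiver.Path.nil.cons α) := by
  rw [wordAction, LinearMap.coprod_apply]
  refine Submodule.add_mem _ (constr_mem μ (startVec_mem I α) _) ?_
  induction n.2 with
  | zero => rw [map_zero]; exact Submodule.zero_mem _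
  | add x y hx hy => rw [map_add]; exact Submodule.add_mem _ hx hy
  | tmul w a =>
    rw [TensorProduct.lift.tmul, Finsupp.linearCombination_apply, Finsupp.sum,
      LinearMap.sum_apply]
    exact Submodule.sum_mem _ fun x _ => Submodule.smul_mem _ _
      (constr_mem (b j) (snocVec_mem I α x) _)

/-- This is the induction step that follows an interleaving arrow by arrow: an appended arrow
lengthens the common suffix, whatever coefficient stands before it. -/
theorem wordAction_mem_cons {j l l' : V} (α : l ⟶ l') (q : Quiver.Path j l) (a : A l)
    {w : WordSpace k κ i τ} (hw : w ∈ suffixSpan I κ i τ q) :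
    wordAction I i b μ α (0, w ⊗ₜ[k] inc l a) ∈ suffixSpan I κ i τ (q.cons α) := by
  let f := wordAction I i b μ α ∘ₗ LinearMap.inr k M (WordSpace k κ i τ ⊗[k] ∀ l, A l) ∘ₗ
    (TensorProduct.mk k (WordSpace k κ i τ) (∀ l, A l)).flip (inc l a)
  have hf : suffixSpan I κ i τ q ≤ (suffixSpan I κ i τ (q.cons α)).comap f := by
    rw [suffixSpan, Submodule.span_le]
    rintro _ ⟨p, s, hs, ⟨y, hy⟩, rfl⟩
    change wordAction I i b μ α (0, Finsupp.single (p, ⟨l, s⟩) 1 ⊗ₜ[k] inc l a) ∈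
      suffixSpan I κ i τ (q.cons α)
    rw [wordAction_inr]
    refine constr_mem (b l) (fun c => ?_) _
    rw [snocVec, dif_pos rfl]
    exact wordVec_mem_suffixSpan I p (y := y) (by rw [Word.path, hy, Quiver.Path.comp_cons])
  exact hf hw

variable [Module (A i)ᵐᵒᵖ M] [IsScalarTower k (A i)ᵐᵒᵖ M]

/-- An arrow from `j` reads only the component at `j` of the last coefficient, and it reads `M` only
if `j = i`; so `1_j` in front of it changes nothing. -/
theorem wordAction_baseAction {j j' : V} (α : j ⟶ j')
    (n : M × (WordSpace k κ i τ ⊗[k] ∀ l, A l)) :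
    wordAction I i b μ α ((baseAction (k := k) A i M (WordSpace k κ i τ) (inc j 1)).unop n) =
      wordAction I i b μ α n := by
  suffices h : wordAction I i b μ α ∘ₗ
      (baseAction (k := k) A i M (WordSpace k κ i τ) (inc j 1)).unop =
      wordAction I i b μ α from
    LinearMap.congr_fun h n
  refine LinearMap.prod_ext (LinearMap.ext fun m => ?_)
    (TensorProduct.ext (Finsupp.lhom_ext' fun x => LinearMap.ext_ring (LinearMap.ext fun a => ?_)))
  · have h1 : (baseAction (k := k) A i M (WordSpace k κ i τ) (inc j 1)).unop (m, 0) =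
        (op ((inc j 1 : ∀ l, A l) i) • m, 0) := by
      ext1
      · rfl
      · exact map_zero (LinearMap.lTensor (WordSpace k κ i τ)
          (LinearMap.mulRight k (inc j 1 : ∀ l, A l)))
    change wordAction I i b μ α
      ((baseAction (k := k) A i M (WordSpace k κ i τ) (inc j 1)).unop (m, 0)) =
      wordAction I i b μ α (m, 0)
    rw [h1, wordAction_inl, wordAction_inl]
    by_cases h : j = i
    · subst h
      rw [inc_same, op_one, one_smul]
    · have h2 : startVec (κ := κ) (i := i) (τ := τ) I α = 0 := by
        funext p
        exact dif_neg h
      rw [h2, map_zero]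
      rfl
  · change wordAction I i b μ α ((baseAction (k := k) A i M (WordSpace k κ i τ) (inc j 1)).unop
      (0, Finsupp.single x 1 ⊗ₜ a)) = wordAction I i b μ α (0, Finsupp.single x 1 ⊗ₜ a)
    rw [baseAction_tmul, wordAction_inr, wordAction_inr, Pi.mul_apply, inc_same, mul_one]

/-- The classes of the formal sequences that do not contain a path of a relation are separated by a
map from the cone to the module of formal sequences. -/
theorem exists_map_words :
    ∃ θ : Cone P I i M →ₗ[k] M × (WordSpace k κ i τ ⊗[k] ∀ l, A l),
      ∀ (p : τ) {j : V} (s : Word κ i j) (a : A j),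
        θ (op (BoundGPA.elem P I j a) • Cone.tmul P I i (μ p) (s.elem P I b)) =
          (0, wordVec I p s ⊗ₜ[k] inc j a) := by
  obtain ⟨θ, h1, h2, h3⟩ := Cone.exists_map_model P I i (wordAction I i b μ)
    (wordAction_baseAction I b μ) (by
    intro Ψ hb ha
    have hint : ∀ {j l : V} (q : Quiver.Path j l) (z : GPA k A), IsInterleaving P q z →
        ∀ n, ∃ w ∈ suffixSpan I κ i τ q, (Ψ z).unop n = (0, w ⊗ₜ[k] inc l 1) := by
      intro j l q z hz n
      induction hz with
      | single β => exact ⟨_, wordAction_mem I b μ β n, ha β n⟩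
      | @cons l _ q z β _ _ γ h ih =>
        obtain ⟨w, hw, hz⟩ := ih
        refine ⟨_, wordAction_mem_cons I b μ β q ((P l).proj (pathElem k γ)) hw, ?_⟩
        rw [map_mul, map_mul, unop_mul, unop_mul, Module.End.mul_apply, Module.End.mul_apply, ha,
          hz, hb, baseAction_tmul, inc_mul_pi, inc_same, one_mul]
    rintro _ ⟨ρ, hρ, f, hf, rfl⟩
    rw [Finsupp.sum, map_sum]
    -- Each term acts as zero by itself, since sequences containing any path of the support have
    -- been set to zero; no cancellation between terms is needed.
    refine Finset.sum_eq_zero fun q hq => ?_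
    have h0 : Ψ (f q) = 0 := by
      apply unop_injective
      refine LinearMap.ext fun n => ?_
      obtain ⟨w, hw, hn⟩ := hint q _ (hf q hq) n
      rw [suffixSpan_eq_bot I hρ hq, Submodule.mem_bot] at hw
      rw [hn, hw, zero_tmul]
      rfl
    rw [map_smul, h0, smul_zero])
  have hsmul : ∀ (p : τ) {j : V} (s : Word κ i j) (a : A j),
      θ (Cone.tmul P I i (μ p) (s.elem P I b)) = (0, wordVec I p s ⊗ₜ[k] inc j 1) →
      θ (op (BoundGPA.elem P I j a) • Cone.tmul P I i (μ p) (s.elem P I b)) =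
        (0, wordVec I p s ⊗ₜ[k] inc j a) := by
    intro p j s a h
    rw [BoundGPA.elem, h2, h, baseAction_tmul, inc_mul_pi, inc_same, one_mul]
  refine ⟨θ, fun p j s a => hsmul p s a ?_⟩
  induction s with
  | single α =>
    have h : Cone.tmul P I i (μ p) ((Word.single (κ := κ) α).elem P I b) =
        op (BoundGPA.arrow P I α) • Cone.tmul P I i (μ p) 1 := by
      rw [Cone.op_smul_tmul, one_mul]
      rfl
    rw [h, h3, h1, wordAction_inl, Module.Basis.constr_basis, startVec, dif_pos rfl]
  | @snoc j l s c α ih =>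
    have h : Cone.tmul P I i (μ p) ((s.snoc c α).elem P I b) = op (BoundGPA.arrow P I α) •
        op (BoundGPA.elem P I j (b j c)) • Cone.tmul P I i (μ p) (s.elem P I b) := rfl
    rw [h, h3, hsmul p s _ (ih 1)]
    -- A longer sequence inherits the paths of relations from its initial part, so both sides vanish
    -- in the first case.
    by_cases hs : ContainsRelationPath I s.path
    · rw [wordVec_of_contains I p hs, wordVec_of_contains I p (s := s.snoc c α) (hs.cons α),
        zero_tmul, Prod.mk_zero_zero, map_zero]
    · rw [wordVec_of_not_contains I p hs, wordAction_inr, inc_same, Module.Basis.constr_basis,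
        snocVec, dif_pos rfl]

end WordModel

/-! ### Bases of the components -/

section Bases

variable {κ : V → Type*} (b : ∀ l, Module.Basis (κ l) k (A l)) {i : V} {M : Type*}
  [AddCommGroup M] [Module k M] [Module (A i)ᵐᵒᵖ M] {τ : Type*} (μ : Module.Basis τ k M)

theorem val_seqClass {j : V} (s : τ × Word κ i j) :
    VertexModule.val P I j (seqClass P I b μ s) = Cone.tmul P I i (μ s.1) (s.2.elem P I b) := rfl

/-- The classes of formal sequences generate the component of the cone at `j ≠ i`. -/
theorem span_seqClass {j : V} (hj : j ≠ i) {S : Set (τ × Word κ i j)}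
    (hS : Submodule.span k (seqClass P I b μ '' S) =
      Submodule.span k (Set.range (seqClass P I b μ (j := j)))) :
    Submodule.span (A j)ᵐᵒᵖ (seqClass P I b μ '' S) = ⊤ := by
  refine eq_top_iff.2 fun y _ => ?_
  have h : Submodule.span k {x | ∃ (p : τ) (s : Word κ i j) (c : κ j),
      x = op (b j c) • seqClass P I b μ (p, s)} ≤
        (Submodule.span (A j)ᵐᵒᵖ (seqClass P I b μ '' S)).restrictScalars k := by
    rw [Submodule.span_le]
    rintro _ ⟨p, s, c, rfl⟩
    have h1 : seqClass P I b μ (p, s) ∈ Submodule.span k (seqClass P I b μ '' S) :=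
      hS ▸ Submodule.subset_span ⟨(p, s), rfl⟩
    have h2 := Submodule.span_le_restrictScalars k (A j)ᵐᵒᵖ (seqClass P I b μ '' S) h1
    exact Submodule.smul_mem (Submodule.span (A j)ᵐᵒᵖ (seqClass P I b μ '' S)) (op (b j c)) h2
  exact h (vertexModule_mem_span P I b μ hj y)

variable [IsScalarTower k (A i)ᵐᵒᵖ M]

theorem linearIndependent_seqClass {j : V} {S : Set (τ × Word κ i j)}
    (hS : LinearIndepOn k (seqClass P I b μ) S) :
    LinearIndependent (A j)ᵐᵒᵖ fun s : S => seqClass P I b μ s.1 := by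
  obtain ⟨θ, -, hθ⟩ := Cone.exists_embedding P I i (M := M)
  refine linearIndependent_of_tmul _ (fun s : S => VertexModule.val P I j (seqClass P I b μ s.1))
    (LinearIndependent.map' hS (VertexModule.val P I j)
      (LinearMap.ker_eq_bot.2 (VertexModule.val_injective P I j)))
    (LinearMap.snd k _ _ ∘ₗ θ ∘ₗ VertexModule.val P I j) ?_
  rintro ⟨⟨p, s⟩, -⟩ a
  -- A formal sequence ends with an arrow, so its class has the form `x α` to which the formula for
  -- `θ` applies.
  have hs : ∃ (l : V) (α : l ⟶ j) (x : Cone P I i M),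
      Cone.tmul P I i (μ p) (s.elem P I b) = op (BoundGPA.arrow P I α) • x := by
    cases s with
    | single α =>
      refine ⟨_, α, Cone.tmul P I i (μ p) 1, ?_⟩
      rw [Cone.op_smul_tmul, one_mul]
      rfl
    | snoc s c α => exact ⟨_, α, Cone.tmul P I i (μ p) (s.elem P I b * _), rfl⟩
  obtain ⟨l, α, x, hx⟩ := hs
  rw [LinearMap.comp_apply, LinearMap.comp_apply, VertexModule.val_smul, val_seqClass, hx, hθ]
  rfl

/-- The map to formal sequences sends these classes to distinct basis vectors. The relations may be
arbitrary here; monomiality enters only for generation. -/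
theorem linearIndependent_seqClass_monomial (j : V) :
    LinearIndependent (A j)ᵐᵒᵖ
      fun s : {s : τ × Word κ i j // ¬ ContainsRelationPath I s.2.path} =>
        seqClass P I b μ s.1 := by
  obtain ⟨θ, hθ⟩ := exists_map_words P I (i := i) b μ
  refine linearIndependent_of_tmul _
    (fun s => (Finsupp.single (s.1.1, ⟨j, s.1.2⟩) 1 : WordSpace k κ i τ))
    ((Finsupp.linearIndependent_single_one k (τ × Σ l, Word κ i l)).comp
      (fun s : {s : τ × Word κ i j // ¬ ContainsRelationPath I s.2.path} =>
        (s.1.1, ⟨j, s.1.2⟩)) ?_)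
    (LinearMap.snd k _ _ ∘ₗ θ ∘ₗ VertexModule.val P I j) ?_
  · rintro ⟨⟨p, s⟩, hs⟩ ⟨⟨p', s'⟩, hs'⟩ h
    simpa using h
  · rintro ⟨⟨p, s⟩, hs⟩ a
    rw [LinearMap.comp_apply, LinearMap.comp_apply, VertexModule.val_smul, val_seqClass,
      unop_op, hθ, wordVec_of_not_contains I p hs]
    rfl

/-- The component of the cone at `i` is `M`. -/
theorem exists_equiv_vertexModule (hV : IsAcyclicQuiver V) :
    ∃ f : M ≃ₗ[(A i)ᵐᵒᵖ] VertexModule P I (Cone P I i M) i,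
      ∀ m, VertexModule.val P I i (f m) = Cone.tmul P I i m 1 := by
  have hone : ∀ (m : M) (a : A i),
      op (BoundGPA.elem P I i a) • Cone.tmul P I i m 1 = Cone.tmul P I i (op a • m) 1 := by
    intro m a
    rw [BoundGPA.elem, Cone.base_smul_tmul_one, inc_same]
  let f : M →ₗ[(A i)ᵐᵒᵖ] VertexModule P I (Cone P I i M) i :=
    { toFun := fun m => (⟨Cone.tmul P I i m 1, Cone.tmul P I i m 1, by
        rw [hone, op_one, one_smul]⟩ : vertexSpace P I (Cone P I i M) i)
      map_add' := fun m n => VertexModule.val_injective P I i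
        (LinearMap.congr_fun (map_add (Cone.tmulHom P I i M) m n) 1)
      map_smul' := fun a m => VertexModule.val_injective P I i (hone m a.unop).symm }
  have hf : ∀ m, VertexModule.val P I i (f m) = Cone.tmul P I i m 1 := fun m => rfl
  refine ⟨LinearEquiv.ofBijective f ⟨fun m n h => ?_, fun y => ?_⟩, hf⟩
  · obtain ⟨θ, hθ, -⟩ := Cone.exists_embedding P I i (M := M)
    -- The first component of `θ` recovers `m` from `m ⊗ 1`.
    have h' := congrArg (fun y => (θ (VertexModule.val P I i y)).1) h
    simpa only [hf, hθ] using h'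
  · obtain ⟨m, hm⟩ := vertexModule_eq_tmul P I hV y
    exact ⟨m, VertexModule.val_injective P I i ((hf m).trans hm.symm)⟩

end Bases

end Bound

end GBP

/-! ### The representation of the cone -/

theorem proposition4p3
    {k : Type*} [Field k] [IsAlgClosed k]
    {V : Type*} [Quiver V] [Finite V] [∀ a b : V, Finite (a ⟶ b)]
    (hV : GBP.IsAcyclicQuiver V)
    {A : V → Type*} [∀ l, Ring (A l)] [∀ l, Algebra k (A l)]
    (P : ∀ l, GBP.BoundPresentation k (A l))
    (I : Set (GBP.Relation k V)) (hI : GBP.IsAdmissible k (GBP.relationIdeal I))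
    (i : V) {M : Type*} [AddCommGroup M] [Module k M] [Module (A i)ᵐᵒᵖ M]
    [IsScalarTower k (A i)ᵐᵒᵖ M] [Module.Finite (A i)ᵐᵒᵖ M]
    {κ : V → Type*} (b : ∀ l, Module.Basis (κ l) k (A l))
    {τ : Type*} (μ : Module.Basis τ k M) :
    -- the vertex `i`
    (∃ f : M ≃ₗ[(A i)ᵐᵒᵖ] GBP.VertexModule P I (GBP.Cone P I i M) i,
      (∀ m, GBP.VertexModule.val P I i (f m) = GBP.Cone.tmul P I i m 1) ∧
      -- the arrows that start at `i`
      ∀ (j' : V) (α : i ⟶ j')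
        (φ : GBP.VertexModule P I (GBP.Cone P I i M) i →ₗ[k]
          GBP.VertexModule P I (GBP.Cone P I i M) j'),
        φ = GBP.arrowMap P I α ↔
          ∀ p : τ, φ (f (μ p)) = GBP.seqClass P I b μ (p, GBP.Word.single α)) ∧
    -- the other vertices
    (∀ j : V, j ≠ i →
      (∃ S : Set (τ × GBP.Word κ i j),
        LinearIndepOn k (GBP.seqClass P I b μ) S ∧
        Submodule.span k (GBP.seqClass P I b μ '' S) =
          Submodule.span k (Set.range (GBP.seqClass P I b μ (j := j)))) ∧
      (∀ S : Set (τ × GBP.Word κ i j),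
        LinearIndepOn k (GBP.seqClass P I b μ) S →
        Submodule.span k (GBP.seqClass P I b μ '' S) =
          Submodule.span k (Set.range (GBP.seqClass P I b μ (j := j))) →
        ∃ B : Module.Basis S (A j)ᵐᵒᵖ (GBP.VertexModule P I (GBP.Cone P I i M) j),
          ∀ s : S, B s = GBP.seqClass P I b μ s.1) ∧
      (GBP.IsMonomial I →
        (∀ s : τ × GBP.Word κ i j, GBP.ContainsRelationPath I s.2.path →
          GBP.seqClass P I b μ s = 0) ∧
        ∃ B : Module.Basis
            {s : τ × GBP.Word κ i j // ¬ GBP.ContainsRelationPath I s.2.path}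
            (A j)ᵐᵒᵖ (GBP.VertexModule P I (GBP.Cone P I i M) j),
          ∀ s, B s = GBP.seqClass P I b μ s.1)) ∧
    -- the arrows that start at another vertex
    (∀ (j j' : V) (α : j ⟶ j'), j ≠ i →
      ∀ φ : GBP.VertexModule P I (GBP.Cone P I i M) j →ₗ[k]
          GBP.VertexModule P I (GBP.Cone P I i M) j',
        φ = GBP.arrowMap P I α ↔
          ∀ (p : τ) (s : GBP.Word κ i j) (c : κ j),
            φ (op (b j c) • GBP.seqClass P I b μ (p, s)) =
              GBP.seqClass P I b μ (p, s.snoc c α)) := by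
  have hsnoc : ∀ {j j' : V} (α : j ⟶ j') (p : τ) (s : GBP.Word κ i j) (c : κ j),
      GBP.arrowMap P I α (op (b j c) • GBP.seqClass P I b μ (p, s)) =
        GBP.seqClass P I b μ (p, s.snoc c α) := fun _ _ _ _ => rfl
  refine ⟨?_, fun j hj => ⟨?_, fun S hS hspan => ?_, fun hmon => ?_⟩, fun j j' α hj φ => ?_⟩
  · obtain ⟨f, hf⟩ := GBP.exists_equiv_vertexModule P I (i := i) (M := M) hV
    refine ⟨f, hf, fun j' α φ => ?_⟩
    have hα : ∀ p, GBP.arrowMap P I α (f (μ p)) =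
        GBP.seqClass P I b μ (p, GBP.Word.single α) := by
      intro p
      apply GBP.VertexModule.val_injective P I
      rw [GBP.VertexModule.val_arrowMap, hf, GBP.Cone.op_smul_tmul, one_mul]
      rfl
    refine ⟨fun h p => h ▸ hα p, fun h => ?_⟩
    have hc := μ.ext (f₁ := φ ∘ₗ (f.restrictScalars k).toLinearMap)
      (f₂ := GBP.arrowMap P I α ∘ₗ (f.restrictScalars k).toLinearMap)
      fun p => (h p).trans (hα p).symm
    refine LinearMap.ext fun y => ?_
    obtain ⟨m, rfl⟩ := f.surjective y
    exact LinearMap.congr_fun hc m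
  -- A maximal independent set of sequences, extending the empty one.
  · obtain ⟨S, -, -, hS, hi⟩ := exists_linearIndepOn_extension (t := Set.univ)
      (linearIndepOn_empty k (GBP.seqClass P I (i := i) b μ (j := j))) (Set.empty_subset _)
    rw [Set.image_univ] at hS
    exact ⟨S, hi, le_antisymm (Submodule.span_mono (Set.image_subset_range _ _))
      (Submodule.span_le.2 hS)⟩
  · refine ⟨Module.Basis.mk (GBP.linearIndependent_seqClass P I b μ hS) ?_, fun s => ?_⟩
    · rw [← GBP.span_seqClass P I b μ hj hspan, Set.image_eq_range]
    · rw [Module.Basis.mk_apply]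
  · have hzero : ∀ s : τ × GBP.Word κ i j, GBP.ContainsRelationPath I s.2.path →
        GBP.seqClass P I b μ s = 0 := by
      intro s hs
      apply GBP.VertexModule.val_injective P I
      rw [GBP.val_seqClass, s.2.elem_eq_zero hmon b hs, map_zero]
      exact map_zero (GBP.Cone.tmulHom P I i M (μ s.1))
    refine ⟨hzero, Module.Basis.mk (GBP.linearIndependent_seqClass_monomial P I (i := i) b μ j) ?_,
      fun s => ?_⟩
    -- All classes together generate, and the omitted ones are zero by `hzero`.
    · rw [← GBP.span_seqClass P I b μ hj (S := Set.univ) (by rw [Set.image_univ]),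
        Submodule.span_le]
      rintro _ ⟨s, -, rfl⟩
      by_cases hs : GBP.ContainsRelationPath I s.2.path
      · rw [hzero s hs]
        exact Submodule.zero_mem _
      · exact Submodule.subset_span ⟨⟨s, hs⟩, rfl⟩
    · rw [Module.Basis.mk_apply]
  · refine ⟨fun h p s c => h ▸ hsnoc α p s c, fun h => LinearMap.ext fun y => ?_⟩
    have hle : (⊤ : Submodule k _) ≤ LinearMap.eqLocus φ (GBP.arrowMap P I α) := by
      refine fun y _ => Submodule.span_le.2 ?_ (GBP.vertexModule_mem_span P I b μ hj y)
      rintro _ ⟨p, s, c, rfl⟩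
      exact (h p s c).trans (hsnoc α p s c).symm
    exact hle trivial
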